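/- Throughout, $I$ is one of $[0,\infty)$, $[0,1]$ (with Lebesgue measure $m$) or $\mathbb N=\{1,2,\dots\}$ (with counting measure $m$), and $L^0(I)$ is the set of classes (modulo equality $m$-a.e.) of measurable functions $I\to\mathbb R$. A Banach ideal space on $I$ is a linear subspace $X\subset L^0(I)$ with a complete norm such that $f\in L^0(I)$, $g\in X$, $|f|\le|g|$ a.e. imply $f\in X$ and $\|f\|_X\le\|g\|_X$, and such that some $f\in X$ satisfies $f>0$ a.e. It has the Fatou property if $0\le f_n\nearrow f\in L^0(I)$ a.e. and $\sup_n\|f_n\|_X<\infty$ imply $f\in X$ and $\|f_n\|_X\nearrow\|f\|_X$. It is symmetric if $f\in X$, $g\in L^0(I)$ and $m\{|f|>\lambda\}=m\{|g|>\lambda\}$ for all $\lambda\ge0$ imply $g\in X$ and $\|g\|_X=\|f\|_X$. The Köthe dual $X'$ consists of all $f\in L^0(I)$ with $\|f\|_{X'}=\sup\{\int_I|fg|\,dm:\|g\|_X\le1\}<\infty$. Put $Cf(x)=\frac1x\int_0^xf(t)\,dt$ and $C^*f(x)=\int_{I\cap[x,\infty)}\frac{f(t)}t\,dt$ if $I$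 is an interval, and $(Ca)_n=\frac1n\sum_{k=1}^na_k$ if $I=\mathbb N$; let $\sigma_\tau f(x)=f(x/\tau)$ for $I=[0,\infty)$, and $\sigma_3a=(a_1,a_1,a_1,a_2,a_2,a_2,\dots)$ for $I=\mathbb N$. An operator is bounded on $X$ if it is defined (a.e.) for all elements of $X$ and maps $X$ boundedly into $X$. For a space $X$ put $CX=\{f\in L^0(I):C|f|\in X\}$ (in particular $C|f|<\infty$ a.e. for $f\in CX$) with $\|f\|_{CX}=\|C|f|\|_X$. Let $\mathcal U$ be the class of all concave functions $\varphi:[0,\infty)^2\to[0,\infty)$ with $\varphi(\lambda s,\lambda t)=\lambda\varphi(s,t)$ for all $\lambda,s,t\ge0$. For $\varphi\in\mathcal U$, $\varphi(X_0,X_1)$ is the space of all $f\in L^0(I)$ such that $|f|\le\lambda\,\varphi(|f_0|,|f_1|)$ a.e. for some $\lambda>0$ and some $f_i\in X_i$ with $\|f_i\|_{X_i}\le1$ $(i=0,1)$; $\|f\|_{\varphi(X_0,X_1)}$ is the infimum of these $\lambda$. **Theorem.** Let $X_0,X_1$ be Banach ideal spaces on $I$ with the Fatou property such that $C$ is bounded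 on $X_0$ and on $X_1$. Suppose that one of the following holds: (i) $I=[0,\infty)$ and, for some $0<\tau<1$, $\sigma_\tau$ is bounded on $X_0$ and on $X_1$; (ii) $I=[0,1]$, $X_0,X_1$ are symmetric, and both $C$ and $C^*$ are bounded on $X_0$ and on $X_1$; (iii) $I=\mathbb N$ and $\sigma_3$ is bounded on $X_0'$ and on $X_1'$. Then, for every $\varphi\in\mathcal U$, $$\varphi(CX_0,CX_1)=C[\varphi(X_0,X_1)],$$ that is, the two spaces have the same elements and their norms are equivalent. -/

import Mathlib

open MeasureTheory Filter Topology Set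
open scoped NNReal ENNReal

noncomputable section

namespace CesaroCL

/-! ### Ideal spaces of classes of measurable functions

A normed space `X ⊆ L⁰(μ)` is given by its norm, extended by the value `∞` off `X`; thus
`X = {f ∈ L⁰(μ) | N f < ∞}`, and `N` is the norm of `X` on this set. -/

section General

variable {α : Type*} [MeasurableSpace α] {μ : Measure α}

/-- The set of elements of the space with extended norm `N`. -/
def carrier (N : (α →ₘ[μ] ℝ) → ℝ≥0∞) : Set (α →ₘ[μ] ℝ) := {f | N f < ∞}

/-- `N` is the extended norm of a Banach ideal space in `L⁰(μ)`: a linear subspace, complete in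
its norm, with the ideal property and with a weak unit. -/
structure IsBanachIdeal (N : (α →ₘ[μ] ℝ) → ℝ≥0∞) : Prop where
  smul : ∀ (c : ℝ) (f : α →ₘ[μ] ℝ), N (c • f) = ‖c‖ₑ * N f
  add_le : ∀ f g : α →ₘ[μ] ℝ, N (f + g) ≤ N f + N g
  eq_zero : ∀ f : α →ₘ[μ] ℝ, N f = 0 → f = 0
  ideal : ∀ f g : α →ₘ[μ] ℝ, |f| ≤ |g| → N f ≤ N g
  complete : ∀ u : ℕ → (α →ₘ[μ] ℝ), (∀ n, u n ∈ carrier N) →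
    (∀ ε : ℝ≥0∞, 0 < ε → ∃ n₀, ∀ m ≥ n₀, ∀ n ≥ n₀, N (u m - u n) ≤ ε) →
    ∃ f ∈ carrier N, Tendsto (fun n => N (u n - f)) atTop (𝓝 0)
  weakUnit : ∃ f ∈ carrier N, ∀ᵐ x ∂μ, 0 < f x

/-- The Fatou property: `0 ≤ fₙ ↗ f` a.e. and `sup ‖fₙ‖ < ∞` imply `f ∈ X` and `‖fₙ‖ ↗ ‖f‖`. -/
def HasFatou (N : (α →ₘ[μ] ℝ) → ℝ≥0∞) : Prop :=
  ∀ (u : ℕ → (α →ₘ[μ] ℝ)) (f : α →ₘ[μ] ℝ), (∀ n, 0 ≤ u n) → Monotone u →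
    (∀ᵐ x ∂μ, Tendsto (fun n => u n x) atTop (𝓝 (f x))) → (⨆ n, N (u n)) < ∞ →
    f ∈ carrier N ∧ Tendsto (fun n => N (u n)) atTop (𝓝 (N f))

/-- Symmetry (rearrangement invariance): equimeasurable functions belong to the space
simultaneously, with the same norm. -/
def IsSymmetric (N : (α →ₘ[μ] ℝ) → ℝ≥0∞) : Prop :=
  ∀ f g : α →ₘ[μ] ℝ, (∀ l : ℝ, 0 ≤ l → μ {x | l < |f x|} = μ {x | l < |g x|}) →
    f ∈ carrier N → g ∈ carrier N ∧ N f = N g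

/-- The norm of the Köthe dual. -/
def kotheDual (N : (α →ₘ[μ] ℝ) → ℝ≥0∞) : (α →ₘ[μ] ℝ) → ℝ≥0∞ :=
  fun f => ⨆ (g : α →ₘ[μ] ℝ) (_ : N g ≤ 1), ∫⁻ x, ‖f x * g x‖ₑ ∂μ

/-- The operator `T`, meaningful on the functions satisfying `D`, is bounded on the space with
norm `N`: it is defined on the whole space and maps it boundedly into itself. -/
def BoundedOn (D : (α →ₘ[μ] ℝ) → Prop) (T : (α →ₘ[μ] ℝ) → (α →ₘ[μ] ℝ))
    (N : (α →ₘ[μ] ℝ) → ℝ≥0∞) : Prop :=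
  ∃ K : ℝ≥0, ∀ f ∈ carrier N, D f ∧ N (T f) ≤ K * N f

/-- Equality of spaces: the same elements, and equivalent norms. -/
def SpaceEq (N M : (α →ₘ[μ] ℝ) → ℝ≥0∞) : Prop :=
  carrier N = carrier M ∧
    ∃ A : ℝ≥0, 0 < A ∧ ∀ f ∈ carrier N, N f ≤ A * M f ∧ M f ≤ A * N f

/-- The class `𝒰` of positively homogeneous concave functions `ℝ₊ × ℝ₊ → ℝ₊`. -/
def ClassU (φ : ℝ≥0 × ℝ≥0 → ℝ≥0) : Prop :=
  (∀ l s t : ℝ≥0, φ (l * s, l * t) = l * φ (s, t)) ∧ ConcaveOn ℝ≥0 univ φ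

/-- The norm of the Calderón–Lozanovskiĭ space `φ(X₀, X₁)` (the infimum of the empty set is
`∞`). -/
def calderonLozanovskii (φ : ℝ≥0 × ℝ≥0 → ℝ≥0) (N₀ N₁ : (α →ₘ[μ] ℝ) → ℝ≥0∞) :
    (α →ₘ[μ] ℝ) → ℝ≥0∞ :=
  fun f => ⨅ (l : ℝ≥0) (_ : 0 < l ∧ ∃ f₀ f₁ : α →ₘ[μ] ℝ, N₀ f₀ ≤ 1 ∧ N₁ f₁ ≤ 1 ∧
    ∀ᵐ x ∂μ, ‖f x‖₊ ≤ l * φ (‖f₀ x‖₊, ‖f₁ x‖₊)), (l : ℝ≥0∞)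

end General

/-! ### Functions on an interval `I = [0, ∞)` or `I = [0, 1]` with Lebesgue measure -/

theorem measurable_setIntegral {s : Set (ℝ × ℝ)} (hs : MeasurableSet s) {f : ℝ → ℝ}
    (hf : StronglyMeasurable f) :
    StronglyMeasurable (fun x : ℝ => ∫ t in {t | (x, t) ∈ s}, f t) := by
  have h : StronglyMeasurable (fun p : ℝ × ℝ => s.indicator (fun p => f p.2) p) :=
    (hf.comp_measurable measurable_snd).indicator hs
  have h2 : StronglyMeasurable (fun x : ℝ => ∫ t, s.indicator (fun p => f p.2) (x, t)) :=
    StronglyMeasurable.integral_prod_right (ν := (volume : Measure ℝ))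
      (f := fun x t => s.indicator (fun p => f p.2) (x, t)) h
  convert h2 using 2 with x
  have hx : MeasurableSet {t | (x, t) ∈ s} := measurable_prodMk_left hs
  rw [← integral_indicator hx]
  rfl

theorem stronglyMeasurable_cesaro {f : ℝ → ℝ} (hf : StronglyMeasurable f) :
    StronglyMeasurable (fun x : ℝ => (1 / x) * ∫ t in (0 : ℝ)..x, f t) := by
  have h1 : StronglyMeasurable (fun x : ℝ => ∫ t in Ioc 0 x, f t) :=
    measurable_setIntegral (s := {p : ℝ × ℝ | 0 < p.2 ∧ p.2 ≤ p.1})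
      ((measurableSet_lt measurable_const measurable_snd).inter
        (measurableSet_le measurable_snd measurable_fst)) hf
  have h2 : StronglyMeasurable (fun x : ℝ => ∫ t in Ioc x 0, f t) :=
    measurable_setIntegral (s := {p : ℝ × ℝ | p.1 < p.2 ∧ p.2 ≤ 0})
      ((measurableSet_lt measurable_fst measurable_snd).inter
        (measurableSet_le measurable_snd measurable_const)) hf
  have h3 : StronglyMeasurable (fun x : ℝ => 1 / x) :=
    (measurable_const.div measurable_id).stronglyMeasurable
  exact h3.mul (h1.sub h2)

theorem stronglyMeasurable_copson {I : Set ℝ} (hI : MeasurableSet I) {f : ℝ → ℝ}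
    (hf : StronglyMeasurable f) :
    StronglyMeasurable (fun x : ℝ => ∫ t in I ∩ Ici x, f t / t) :=
  measurable_setIntegral (s := {p : ℝ × ℝ | p.2 ∈ I ∧ p.1 ≤ p.2})
    ((measurable_snd hI).inter (measurableSet_le measurable_fst measurable_snd))
    (hf.measurable.div measurable_id).stronglyMeasurable

/-- The Cesàro operator `Cf(x) = (1/x) ∫₀ˣ f(t) dt`, `x ∈ I`. -/
def cesaro {I : Set ℝ} (f : ℝ →ₘ[volume.restrict I] ℝ) : ℝ →ₘ[volume.restrict I] ℝ :=
  AEEqFun.mk (fun x => (1 / x) * ∫ t in (0 : ℝ)..x, f t)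
    (stronglyMeasurable_cesaro f.stronglyMeasurable).aestronglyMeasurable

/-- `Cf(x)` is meaningful for almost every `x ∈ I`. -/
def CesaroDefined {I : Set ℝ} (f : ℝ →ₘ[volume.restrict I] ℝ) : Prop :=
  ∀ᵐ x ∂(volume.restrict I), IntervalIntegrable f volume 0 x

/-- The Copson operator `C*f(x) = ∫_{I ∩ [x, ∞)} f(t)/t dt` on `I = [0, 1]`. -/
def copson (f : ℝ →ₘ[volume.restrict (Icc (0 : ℝ) 1)] ℝ) :
    ℝ →ₘ[volume.restrict (Icc (0 : ℝ) 1)] ℝ :=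
  AEEqFun.mk (fun x => ∫ t in Icc (0 : ℝ) 1 ∩ Ici x, f t / t)
    (stronglyMeasurable_copson measurableSet_Icc f.stronglyMeasurable).aestronglyMeasurable

/-- `C*f(x)` is meaningful for almost every `x ∈ [0, 1]`. -/
def CopsonDefined (f : ℝ →ₘ[volume.restrict (Icc (0 : ℝ) 1)] ℝ) : Prop :=
  ∀ᵐ x ∂(volume.restrict (Icc (0 : ℝ) 1)),
    IntegrableOn (fun t => f t / t) (Icc (0 : ℝ) 1 ∩ Ici x) volume

/-- The dilation operator `σ_τ f(x) = f(x/τ)` on `I = [0, ∞)`. -/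
def dilation (τ : ℝ) (f : ℝ →ₘ[volume.restrict (Ici (0 : ℝ))] ℝ) :
    ℝ →ₘ[volume.restrict (Ici (0 : ℝ))] ℝ :=
  AEEqFun.mk (fun x => f (x / τ))
    (f.stronglyMeasurable.comp_measurable
      (measurable_id.div_const τ)).aestronglyMeasurable

open Classical in
/-- The norm of the Cesàro space `CX = {f ∈ L⁰(I) | C|f| ∈ X}`, `‖f‖_{CX} = ‖C|f|‖_X`. Functions
for which `C|f|` is not finite a.e. do not belong to `CX`. -/
def cesaroSpace {I : Set ℝ} (N : (ℝ →ₘ[volume.restrict I] ℝ) → ℝ≥0∞) :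
    (ℝ →ₘ[volume.restrict I] ℝ) → ℝ≥0∞ :=
  fun f => if CesaroDefined |f| then N (cesaro |f|) else ∞

/-! ### Sequences

A sequence `(a₁, a₂, …)` is represented by the function `n ↦ aₙ₊₁` on `ℕ = {0, 1, …}`, with
counting measure. -/

/-- The discrete Cesàro operator, `(Ca)ₙ = (a₁ + … + aₙ)/n` for `n ≥ 1`. -/
def cesaroSeq (a : ℕ →ₘ[Measure.count] ℝ) : ℕ →ₘ[Measure.count] ℝ :=
  AEEqFun.mk (fun n => (1 / ((n : ℝ) + 1)) * ∑ k ∈ Finset.range (n + 1), a k)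
    (measurable_of_countable _).aestronglyMeasurable

/-- The dilation operator `σ_m a = (a₁, …, a₁, a₂, …, a₂, …)`, each term repeated `m` times. -/
def dilationSeq (m : ℕ) (a : ℕ →ₘ[Measure.count] ℝ) : ℕ →ₘ[Measure.count] ℝ :=
  AEEqFun.mk (fun n => a (n / m)) (measurable_of_countable _).aestronglyMeasurable

/-- The norm of the Cesàro sequence space `CX`, `‖a‖_{CX} = ‖C|a|‖_X`. -/
def cesaroSeqSpace (N : (ℕ →ₘ[Measure.count] ℝ) → ℝ≥0∞) : (ℕ →ₘ[Measure.count] ℝ) → ℝ≥0∞ :=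
  fun a => N (cesaroSeq |a|)

end CesaroCL

end

/-!
The inclusion `φ(CX₀, CX₁) ⊆ C[φ(X₀, X₁)]` is Jensen's inequality for `φ`
(`ClassU.lintegral_le`): `C φ(|f₀|, |f₁|) ≤ 2 φ(C|f₀|, C|f₁|)`.

For the converse let `f ≥ 0` and `Cf ≤ φ(g₀, g₁)` with `gᵢ` in the unit ball of `Xᵢ`; one has to
find `fᵢ` with `f ≤ φ(f₀, f₁)` and `C fᵢ` controlled in `Xᵢ` (`HasDecomposition`). Averaging the
hypothesis once more gives `∫₀^{τx} f ≤ c φ(V₀(x), V₁(x))` with the increasing functions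
`Vᵢ(x) = ∫₀ˣ gᵢ` (`cumul_mul_le`). On the block `(τᵏ⁺¹, τᵏ]` put
`fᵢ = f · Vᵢ(τᵏ⁻¹) / φ(V₀(τᵏ⁻¹), V₁(τᵏ⁻¹))`. The coefficients being constant on the block,
`φ(f₀, f₁) = f` by homogeneity, and `fᵢ` has mass at most `c Vᵢ(τᵏ⁻¹)` on it. As `Vᵢ` increases, this
is at most a multiple of `∫ Vᵢ(t) dt/t` over the block `(τᵏ⁻¹, τᵏ⁻²]`, and summing over the blocks
below `x` gives `C fᵢ(x) ≤ c' (C C gᵢ)(x/τ³)` (`exists_block_decomposition`,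
`hasDecomposition_of_dilation`). So on `[0, ∞)` the boundedness of `C` and of `σ_τ` suffices.

On `ℕ` the same argument with `τ = 1/3` needs the boundedness of `b ↦ (b₃, b₆, b₉, …)`, which
follows from that of `σ₃` on the Köthe dual by the Hahn–Banach theorem for finite sequences and the
Fatou property (`posBounded_subsequence`).

On `[0, 1]` the part of `f` on `(0, 1/16]` is treated in the same way, the dilation of the function
`C C gᵢ` being controlled by `C*` near `0` and by a constant elsewhere. On `(1/16, 1]` the weight
`1/x` is harmless, and after the reflection `x ↦ 1 - x`, an isometry by symmetry, the block argument
applies to the decreasing function `∫_y^1`; there the averages with respect to `dt/t` are given by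
`C*`, and the remaining dilation of a decreasing function is controlled by `C`.

All three cases use one block decomposition, for a measure space whose points have a real position
`p`: `p = id` on intervals, `p n = n + 1` on `ℕ`, and `p s = 1/s` in the reflected variable.
Boundedness of operators is expressed on functions with values in `[0, ∞]` through domination by
elements of the space (`Dominated`, `PosBounded`).
-/

namespace CesaroCL

/-! ### The class `𝒰` -/

section ClassU

variable {φ : ℝ≥0 × ℝ≥0 → ℝ≥0}

theorem ClassU.map_add_le (hφ : ClassU φ) (a b : ℝ≥0 × ℝ≥0) : φ a + φ b ≤ φ (a + b) := by
  obtain ⟨-, hc⟩ := hφ.2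
  have h := hc (x := (2 * a.1, 2 * a.2)) (y := (2 * b.1, 2 * b.2)) (mem_univ _) (mem_univ _)
    (a := (2⁻¹ : ℝ≥0)) (b := (2⁻¹ : ℝ≥0)) zero_le zero_le (by rw [← two_mul]; exact mul_inv_cancel₀ two_ne_zero)
  simp only [hφ.1, smul_eq_mul, Prod.smul_mk, Prod.mk_add_mk] at h
  simp only [← mul_assoc, inv_mul_cancel₀ (two_ne_zero (α := ℝ≥0)), one_mul] at h
  exact h

theorem ClassU.mono (hφ : ClassU φ) {s t s' t' : ℝ≥0} (h1 : s ≤ s') (h2 : t ≤ t') :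
    φ (s, t) ≤ φ (s', t') := by
  have h := hφ.map_add_le (s, t) (s' - s, t' - t)
  rw [Prod.mk_add_mk, add_tsub_cancel_of_le h1, add_tsub_cancel_of_le h2] at h
  exact le_self_add.trans h

/-- Jensen's inequality for `φ ∈ 𝒰`. The constant `2` comes from replacing a supporting functional
of `φ` at `(S, T)` by `(s, t) ↦ φ (S, T) (s / S + t / T)`, which majorizes `φ` by monotonicity and
homogeneity. -/
theorem ClassU.lintegral_le {α : Type*} [MeasurableSpace α] {ν : Measure α} (hφ : ClassU φ)
    {g₀ g₁ : α → ℝ≥0} (h₀ : AEMeasurable g₀ ν) (h₁ : AEMeasurable g₁ ν) {S T : ℝ≥0}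
    (hS : ∫⁻ x, g₀ x ∂ν ≤ S) (hT : ∫⁻ x, g₁ x ∂ν ≤ T) :
    ∫⁻ x, φ (g₀ x, g₁ x) ∂ν ≤ 2 * φ (S, T) := by
  rcases eq_or_ne S 0 with rfl | hS0
  · have hz : ∀ᵐ x ∂ν, g₀ x = 0 := by
      have := (lintegral_eq_zero_iff' h₀.coe_nnreal_ennreal).1 (le_antisymm (by simpa using hS) zero_le)
      filter_upwards [this] with x hx
      simpa using hx
    calc ∫⁻ x, φ (g₀ x, g₁ x) ∂ν = ∫⁻ x, φ (0, 1) * (g₁ x : ℝ≥0∞) ∂ν := by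
          refine lintegral_congr_ae ?_
          filter_upwards [hz] with x hx
          have := hφ.1 (g₁ x) 0 1
          rw [mul_zero, mul_one] at this
          rw [hx, this, mul_comm, ENNReal.coe_mul]
      _ = φ (0, 1) * ∫⁻ x, (g₁ x : ℝ≥0∞) ∂ν := lintegral_const_mul' _ _ ENNReal.coe_ne_top
      _ ≤ φ (0, 1) * T := by gcongr
      _ = φ (0, T) := by
          have := hφ.1 T 0 1
          rw [mul_zero, mul_one] at this
          rw [this, mul_comm, ENNReal.coe_mul]
      _ ≤ 2 * φ (0, T) := le_mul_of_one_le_left zero_le one_le_two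
  rcases eq_or_ne T 0 with rfl | hT0
  · have hz : ∀ᵐ x ∂ν, g₁ x = 0 := by
      have := (lintegral_eq_zero_iff' h₁.coe_nnreal_ennreal).1 (le_antisymm (by simpa using hT) zero_le)
      filter_upwards [this] with x hx
      simpa using hx
    calc ∫⁻ x, φ (g₀ x, g₁ x) ∂ν = ∫⁻ x, φ (1, 0) * (g₀ x : ℝ≥0∞) ∂ν := by
          refine lintegral_congr_ae ?_
          filter_upwards [hz] with x hx
          have := hφ.1 (g₀ x) 1 0
          rw [mul_zero, mul_one] at this
          rw [hx, this, mul_comm, ENNReal.coe_mul]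
      _ = φ (1, 0) * ∫⁻ x, (g₀ x : ℝ≥0∞) ∂ν := lintegral_const_mul' _ _ ENNReal.coe_ne_top
      _ ≤ φ (1, 0) * S := by gcongr
      _ = φ (S, 0) := by
          have := hφ.1 S 1 0
          rw [mul_zero, mul_one] at this
          rw [this, mul_comm, ENNReal.coe_mul]
      _ ≤ 2 * φ (S, 0) := le_mul_of_one_le_left zero_le one_le_two
  have key : ∀ s t : ℝ≥0, φ (s, t) ≤ φ (S, T) * S⁻¹ * s + φ (S, T) * T⁻¹ * t := by
    intro s t
    have h := hφ.mono (s := s) (t := t) (s' := (S⁻¹ * s + T⁻¹ * t) * S)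
      (t' := (S⁻¹ * s + T⁻¹ * t) * T) ?_ ?_
    · rw [hφ.1] at h
      calc _ ≤ _ := h
        _ = _ := by ring
    · rw [add_mul, mul_right_comm, inv_mul_cancel₀ hS0, one_mul]; exact le_self_add
    · rw [add_mul, mul_right_comm T⁻¹, inv_mul_cancel₀ hT0, one_mul]; exact le_add_self
  calc ∫⁻ x, φ (g₀ x, g₁ x) ∂ν
      ≤ ∫⁻ x, ((φ (S, T) * S⁻¹ : ℝ≥0) : ℝ≥0∞) * g₀ x + ((φ (S, T) * T⁻¹ : ℝ≥0) : ℝ≥0∞) * g₁ x ∂ν := by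
        refine lintegral_mono fun x => ?_
        rw [← ENNReal.coe_mul, ← ENNReal.coe_mul, ← ENNReal.coe_add, ENNReal.coe_le_coe]
        exact key (g₀ x) (g₁ x)
    _ = ((φ (S, T) * S⁻¹ : ℝ≥0) : ℝ≥0∞) * ∫⁻ x, g₀ x ∂ν
        + ((φ (S, T) * T⁻¹ : ℝ≥0) : ℝ≥0∞) * ∫⁻ x, g₁ x ∂ν := by
        rw [lintegral_add_left' (h₀.coe_nnreal_ennreal.const_mul _),
          lintegral_const_mul' _ _ ENNReal.coe_ne_top, lintegral_const_mul' _ _ ENNReal.coe_ne_top]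
    _ ≤ ((φ (S, T) * S⁻¹ : ℝ≥0) : ℝ≥0∞) * S + ((φ (S, T) * T⁻¹ : ℝ≥0) : ℝ≥0∞) * T := by gcongr
    _ = 2 * φ (S, T) := by
        norm_cast
        rw [mul_assoc, inv_mul_cancel₀ hS0, mul_assoc, inv_mul_cancel₀ hT0]
        ring

end ClassU

/-! ### Domination by elements of an ideal space -/

section Dominated

variable {α : Type*} [MeasurableSpace α] {μ : Measure α} {N : (α →ₘ[μ] ℝ) → ℝ≥0∞}

/-- The monotonicity of the norm of an ideal space. -/
def IsIdealNorm (N : (α →ₘ[μ] ℝ) → ℝ≥0∞) : Prop :=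
  ∀ f g : α →ₘ[μ] ℝ, (∀ᵐ x ∂μ, ‖f x‖ₑ ≤ ‖g x‖ₑ) → N f ≤ N g

theorem IsBanachIdeal.isIdealNorm (hN : IsBanachIdeal N) : IsIdealNorm N := by
  intro f g h
  refine hN.ideal f g ?_
  rw [← AEEqFun.coeFn_le]
  filter_upwards [h, AEEqFun.coeFn_abs f, AEEqFun.coeFn_abs g] with x hx h1 h2
  rw [h1, h2]
  rwa [enorm_le_iff_norm_le, Real.norm_eq_abs, Real.norm_eq_abs] at hx

/-- `g` is a.e. dominated by an element of norm at most `k` of the space with norm `N`. No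
measurability of `g` is required. -/
def Dominated (N : (α →ₘ[μ] ℝ) → ℝ≥0∞) (k : ℝ≥0) (g : α → ℝ≥0∞) : Prop :=
  ∃ h : α →ₘ[μ] ℝ, N h ≤ k ∧ ∀ᵐ x ∂μ, g x ≤ ‖h x‖ₑ

theorem Dominated.mono {k l : ℝ≥0} {g g' : α → ℝ≥0∞} (hg : Dominated N k g) (hkl : k ≤ l)
    (h : ∀ᵐ x ∂μ, g' x ≤ g x) : Dominated N l g' := by
  obtain ⟨u, hu, hgu⟩ := hg
  refine ⟨u, hu.trans (by exact_mod_cast hkl), ?_⟩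
  filter_upwards [h, hgu] with x h1 h2 using h1.trans h2

theorem Dominated.lt_top {k : ℝ≥0} {g : α → ℝ≥0∞} (hg : Dominated N k g) :
    ∀ᵐ x ∂μ, g x < ∞ := by
  obtain ⟨u, hu, hgu⟩ := hg
  filter_upwards [hgu] with x hx using hx.trans_lt enorm_lt_top

theorem Dominated.add (hN : IsBanachIdeal N) {k l : ℝ≥0} {g g' : α → ℝ≥0∞}
    (hg : Dominated N k g) (hg' : Dominated N l g') :
    Dominated N (k + l) (fun x => g x + g' x) := by
  obtain ⟨u, hu, hgu⟩ := hg
  obtain ⟨v, hv, hgv⟩ := hg'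
  have habs : ∀ w : α →ₘ[μ] ℝ, N |w| ≤ N w := fun w => hN.isIdealNorm _ _ (by
    filter_upwards [AEEqFun.coeFn_abs w] with x hx
    rw [hx, Real.enorm_abs])
  refine ⟨|u| + |v|, (hN.add_le _ _).trans ?_, ?_⟩
  · push_cast
    exact add_le_add ((habs u).trans hu) ((habs v).trans hv)
  · filter_upwards [hgu, hgv, AEEqFun.coeFn_add |u| |v|, AEEqFun.coeFn_abs u,
      AEEqFun.coeFn_abs v] with x h1 h2 h3 h4 h5
    rw [h3, Pi.add_apply, h4, h5, Real.enorm_of_nonneg (by positivity),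
      ENNReal.ofReal_add (abs_nonneg _) (abs_nonneg _), ← Real.enorm_eq_ofReal_abs,
      ← Real.enorm_eq_ofReal_abs]
    exact add_le_add h1 h2

theorem Dominated.const_mul (hN : IsBanachIdeal N) {k : ℝ≥0} {g : α → ℝ≥0∞}
    (hg : Dominated N k g) (c : ℝ≥0) : Dominated N (c * k) (fun x => c * g x) := by
  obtain ⟨u, hu, hgu⟩ := hg
  have hc : ‖(c : ℝ)‖ₑ = c := by
    rw [Real.enorm_of_nonneg (NNReal.coe_nonneg c), ENNReal.ofReal_coe_nnreal]
  refine ⟨(c : ℝ) • u, ?_, ?_⟩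
  · rw [hN.smul, ENNReal.coe_mul, hc]
    gcongr
  · filter_upwards [hgu, AEEqFun.coeFn_smul (c : ℝ) u] with x h1 h2
    rw [h2, Pi.smul_apply, enorm_smul, hc]
    gcongr

theorem Dominated.norm_le (hN : IsIdealNorm N) {k : ℝ≥0} {f : α →ₘ[μ] ℝ}
    (h : Dominated N k (fun x => ‖f x‖ₑ)) : N f ≤ k := by
  obtain ⟨u, hu, hgu⟩ := h
  exact (hN f u hgu).trans hu

theorem dominated_enorm {k : ℝ≥0} {f : α →ₘ[μ] ℝ} (h : N f ≤ k) :
    Dominated N k (fun x => ‖f x‖ₑ) := ⟨f, h, ae_of_all _ fun _ => le_rfl⟩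

/-- A measurable, a.e. finite function with values in `[0, ∞]` as an element of `L⁰`. -/
theorem exists_enorm_eq {g : α → ℝ≥0∞} (hg : Measurable g) (hfin : ∀ᵐ x ∂μ, g x < ∞) :
    ∃ h : α →ₘ[μ] ℝ, ∀ᵐ x ∂μ, ‖h x‖ₑ = g x := by
  refine ⟨AEEqFun.mk (fun x => (g x).toReal) hg.ennreal_toReal.aestronglyMeasurable, ?_⟩
  filter_upwards [hfin, AEEqFun.coeFn_mk (fun x => (g x).toReal)
    hg.ennreal_toReal.aestronglyMeasurable] with x h1 h2
  rw [h2, Real.enorm_of_nonneg ENNReal.toReal_nonneg, ENNReal.ofReal_toReal h1.ne]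

end Dominated

section CL

variable {α : Type*} [MeasurableSpace α] {μ : Measure α} {N₀ N₁ : (α →ₘ[μ] ℝ) → ℝ≥0∞}
  {φ : ℝ≥0 × ℝ≥0 → ℝ≥0}

theorem isIdealNorm_calderonLozanovskii : IsIdealNorm (calderonLozanovskii φ N₀ N₁) := by
  intro f g h
  refine le_iInf₂ fun l hl => ?_
  obtain ⟨hl0, f₀, f₁, h0, h1, hle⟩ := hl
  refine iInf₂_le l ⟨hl0, f₀, f₁, h0, h1, ?_⟩
  filter_upwards [h, hle] with x hx1 hx2
  exact le_trans (by rwa [enorm_eq_nnnorm, enorm_eq_nnnorm, ENNReal.coe_le_coe] at hx1) hx2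

end CL

/-! ### Averages over initial segments -/

section Average

variable {α : Type*} [MeasurableSpace α]

/-- The mass `∫_{p ≤ x} g dμ` that `g` carries on the initial segment of points whose position,
given by the function `p`, is at most `x`. -/
noncomputable def cumul (μ : Measure α) (p : α → ℝ) (g : α → ℝ≥0∞) (x : ℝ) : ℝ≥0∞ :=
  ∫⁻ y in {y | p y ≤ x}, g y ∂μ

/-- The Cesàro operator on nonnegative functions, for all three choices of `I` at once: for
`p = id` this is `(1/y) ∫₀ʸ g`, and for `p n = n + 1` on `ℕ` it is the mean of the first `n + 1`
terms. -/
noncomputable def cesaroAvg (μ : Measure α) (p : α → ℝ) (g : α → ℝ≥0∞) (y : α) : ℝ≥0∞ :=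
  cumul μ p g (p y) / ENNReal.ofReal (p y)

variable {μ : Measure α} {p : α → ℝ}

theorem cumul_mono (g : α → ℝ≥0∞) : Monotone (cumul μ p g) := fun _ _ h =>
  lintegral_mono_set fun _ hy => le_trans hy h

theorem cumul_le_cumul {g g' : α → ℝ≥0∞} (h : ∀ᵐ x ∂μ, g x ≤ g' x) (x : ℝ) :
    cumul μ p g x ≤ cumul μ p g' x :=
  lintegral_mono_ae (ae_restrict_of_ae h)

theorem measurable_cesaroAvg (hp : Measurable p) (g : α → ℝ≥0∞) :
    Measurable (cesaroAvg μ p g) :=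
  ((cumul_mono g).measurable.comp hp).div hp.ennreal_ofReal

theorem cesaroAvg_le_cesaroAvg {g g' : α → ℝ≥0∞} (h : ∀ᵐ x ∂μ, g x ≤ g' x) (y : α) :
    cesaroAvg μ p g y ≤ cesaroAvg μ p g' y :=
  ENNReal.div_le_div_right (cumul_le_cumul h _) _

theorem cumul_const_mul (c : ℝ≥0) (g : α → ℝ≥0∞) (x : ℝ) :
    cumul μ p (fun y => c * g y) x = c * cumul μ p g x :=
  lintegral_const_mul' _ _ ENNReal.coe_ne_top

theorem cesaroAvg_const_mul (c : ℝ≥0) (g : α → ℝ≥0∞) (y : α) :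
    cesaroAvg μ p (fun y => c * g y) y = c * cesaroAvg μ p g y := by
  rw [cesaroAvg, cesaroAvg, cumul_const_mul, mul_div_assoc]

theorem cumul_lt_top {g : α → ℝ≥0∞} {y : α} (h : cesaroAvg μ p g y < ∞) :
    cumul μ p g (p y) < ∞ := by
  by_contra hc
  rw [not_lt, top_le_iff] at hc
  rw [cesaroAvg, hc, ENNReal.top_div_of_ne_top ENNReal.ofReal_ne_top] at h
  exact lt_irrefl _ h

end Average

/-! ### The embedding `φ(CX₀, CX₁) ⊆ C[φ(X₀, X₁)]` and the reduction to a decomposition -/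

section Reduction

variable {α : Type*} [MeasurableSpace α] {μ : Measure α} {p : α → ℝ}
  {N₀ N₁ M₀ M₁ M : (α →ₘ[μ] ℝ) → ℝ≥0∞} {φ : ℝ≥0 × ℝ≥0 → ℝ≥0}

/-- `M` is the norm of the Cesàro space of the space with norm `N`. -/
def IsCesaroNorm (p : α → ℝ) (N M : (α →ₘ[μ] ℝ) → ℝ≥0∞) : Prop :=
  ∀ (f : α →ₘ[μ] ℝ) (k : ℝ≥0), M f ≤ k ↔ Dominated N k (cesaroAvg μ p fun x => ‖f x‖ₑ)

/-- The decomposition property: if `Cf ≤ φ(g₀, g₁)` with `gᵢ` in the unit ball of `Xᵢ`, then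
`f ≤ φ(f₀, f₁)` with `C fᵢ` in a fixed multiple of the unit ball of `Xᵢ`. -/
def HasDecomposition (p : α → ℝ) (φ : ℝ≥0 × ℝ≥0 → ℝ≥0) (N₀ N₁ : (α →ₘ[μ] ℝ) → ℝ≥0∞) : Prop :=
  ∃ c : ℝ≥0, ∀ f g₀ g₁ : α → ℝ≥0, Measurable f → Measurable g₀ → Measurable g₁ →
    Dominated N₀ 1 (fun x => g₀ x) → Dominated N₁ 1 (fun x => g₁ x) →
    (∀ᵐ x ∂μ, cesaroAvg μ p (fun x => f x) x ≤ φ (g₀ x, g₁ x)) →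
    ∃ f₀ f₁ : α → ℝ≥0, Measurable f₀ ∧ Measurable f₁ ∧ (∀ᵐ x ∂μ, f x ≤ φ (f₀ x, f₁ x)) ∧
      Dominated N₀ c (cesaroAvg μ p fun x => f₀ x) ∧ Dominated N₁ c (cesaroAvg μ p fun x => f₁ x)

theorem cesaroNorm_le_calderonLozanovskii (hφ : ClassU φ) (hp : Measurable p)
    (hp0 : ∀ᵐ x ∂μ, 0 < p x) (h₀ : IsCesaroNorm p N₀ M₀) (h₁ : IsCesaroNorm p N₁ M₁)
    (hM : IsCesaroNorm p (calderonLozanovskii φ N₀ N₁) M) (f : α →ₘ[μ] ℝ) :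
    M f ≤ 2 * calderonLozanovskii φ M₀ M₁ f := by
  unfold calderonLozanovskii
  rw [ENNReal.mul_iInf_of_ne two_ne_zero ENNReal.ofNat_ne_top]
  refine le_iInf fun l => ?_
  rw [ENNReal.mul_iInf_of_ne two_ne_zero ENNReal.ofNat_ne_top]
  refine le_iInf fun hl => ?_
  obtain ⟨hl0, f₀, f₁, hf₀, hf₁, hle⟩ := hl
  obtain ⟨u₀, hu₀, hu₀'⟩ := (h₀ f₀ 1).1 (by simpa using hf₀)
  obtain ⟨u₁, hu₁, hu₁'⟩ := (h₁ f₁ 1).1 (by simpa using hf₁)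
  have hmain : ∀ᵐ y ∂μ, cesaroAvg μ p (fun x => ‖f x‖ₑ) y
      ≤ ((2 * l * φ (‖u₀ y‖₊, ‖u₁ y‖₊) : ℝ≥0) : ℝ≥0∞) := by
    filter_upwards [hu₀', hu₁', hp0] with y h0 h1 hy
    have e0 := (cumul_lt_top (h0.trans_lt enorm_lt_top)).ne
    have e1 := (cumul_lt_top (h1.trans_lt enorm_lt_top)).ne
    set S := (cumul μ p (fun x => ‖f₀ x‖ₑ) (p y)).toNNReal with hS
    set T := (cumul μ p (fun x => ‖f₁ x‖ₑ) (p y)).toNNReal with hT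
    have eS : (S : ℝ≥0∞) = cumul μ p (fun x => ‖f₀ x‖ₑ) (p y) := ENNReal.coe_toNNReal e0
    have eT : (T : ℝ≥0∞) = cumul μ p (fun x => ‖f₁ x‖ₑ) (p y) := ENNReal.coe_toNNReal e1
    have J := hφ.lintegral_le (ν := μ.restrict {z | p z ≤ p y})
      (g₀ := fun x => ‖f₀ x‖₊) (g₁ := fun x => ‖f₁ x‖₊)
      f₀.stronglyMeasurable.measurable.nnnorm.aemeasurable
      f₁.stronglyMeasurable.measurable.nnnorm.aemeasurable eS.ge eT.ge
    have hc : cumul μ p (fun x => ‖f x‖ₑ) (p y) ≤ ((l * (2 * φ (S, T)) : ℝ≥0) : ℝ≥0∞) := by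
      refine (cumul_le_cumul (g' := fun x => (l : ℝ≥0∞) * φ (‖f₀ x‖₊, ‖f₁ x‖₊)) ?_ _).trans ?_
      · filter_upwards [hle] with x hx
        exact_mod_cast hx
      · rw [cumul_const_mul]
        push_cast
        gcongr
        exact J
    set r : ℝ≥0 := Real.toNNReal (p y) with hr
    have hr0 : r ≠ 0 := by simpa [hr] using hy
    have eu0 : r⁻¹ * S ≤ ‖u₀ y‖₊ := by
      rw [cesaroAvg, ← eS] at h0
      change (S : ℝ≥0∞) / (r : ℝ≥0∞) ≤ (‖u₀ y‖₊ : ℝ≥0∞) at h0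
      rw [← ENNReal.coe_div hr0, ENNReal.coe_le_coe, div_eq_inv_mul] at h0
      exact h0
    have eu1 : r⁻¹ * T ≤ ‖u₁ y‖₊ := by
      rw [cesaroAvg, ← eT] at h1
      change (T : ℝ≥0∞) / (r : ℝ≥0∞) ≤ (‖u₁ y‖₊ : ℝ≥0∞) at h1
      rw [← ENNReal.coe_div hr0, ENNReal.coe_le_coe, div_eq_inv_mul] at h1
      exact h1
    have hm := hφ.mono eu0 eu1
    rw [hφ.1] at hm
    calc cesaroAvg μ p (fun x => ‖f x‖ₑ) y
        ≤ ((l * (2 * φ (S, T)) : ℝ≥0) : ℝ≥0∞) / (r : ℝ≥0∞) := ENNReal.div_le_div_right hc _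
      _ = ((2 * l * (r⁻¹ * φ (S, T)) : ℝ≥0) : ℝ≥0∞) := by
          rw [← ENNReal.coe_div hr0]
          congr 1
          rw [div_eq_mul_inv]; ring
      _ ≤ _ := by
          rw [ENNReal.coe_le_coe]
          gcongr
  obtain ⟨h, hh⟩ := exists_enorm_eq (measurable_cesaroAvg hp _)
    (hmain.mono fun y hy => hy.trans_lt ENNReal.coe_lt_top)
  have : M f ≤ ((2 * l : ℝ≥0) : ℝ≥0∞) := by
    refine (hM f _).2 ⟨h, ?_, hh.mono fun y hy => hy.ge⟩
    refine iInf₂_le (2 * l) ⟨by positivity, u₀, u₁, by simpa using hu₀, by simpa using hu₁, ?_⟩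
    filter_upwards [hh, hmain] with y h1 h2
    rw [← h1] at h2
    exact_mod_cast h2
  simpa using this

theorem spaceEq_of_hasDecomposition (hφ : ClassU φ) (hp : Measurable p)
    (hp0 : ∀ᵐ x ∂μ, 0 < p x) (hN₀ : IsBanachIdeal N₀) (hN₁ : IsBanachIdeal N₁)
    (h₀ : IsCesaroNorm p N₀ M₀) (h₁ : IsCesaroNorm p N₁ M₁)
    (hM : IsCesaroNorm p (calderonLozanovskii φ N₀ N₁) M) (hd : HasDecomposition p φ N₀ N₁) :
    SpaceEq (calderonLozanovskii φ M₀ M₁) M := by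
  have hfwd := cesaroNorm_le_calderonLozanovskii hφ hp hp0 h₀ h₁ hM
  obtain ⟨c, hc⟩ := hd
  have hbwd : ∀ f, calderonLozanovskii φ M₀ M₁ f ≤ ((c + 1 : ℝ≥0) : ℝ≥0∞) * M f := by
    intro f
    rcases eq_or_ne (M f) ∞ with htop | htop
    · rw [htop, ENNReal.mul_top (by positivity)]
      exact le_top
    lift M f to ℝ≥0 using htop with k hk
    obtain ⟨h, hhk, hh⟩ := (hM f k).1 hk.ge
    refine ENNReal.le_of_forall_pos_le_add fun ε hε _ => ?_
    have hc1 : (c + 1 : ℝ≥0) ≠ 0 := by positivity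
    -- a factor admissible for `h` and only slightly larger than `k`
    have hlt : calderonLozanovskii φ N₀ N₁ h < ((k + ε / (c + 1) : ℝ≥0) : ℝ≥0∞) :=
      hhk.trans_lt (by
        rw [ENNReal.coe_lt_coe]
        exact lt_add_of_pos_right _ (by positivity))
    simp only [calderonLozanovskii, iInf_lt_iff] at hlt
    obtain ⟨l, ⟨hl0, g₀, g₁, hg₀, hg₁, hle⟩, hl⟩ := hlt
    have hl' : l ≠ 0 := hl0.ne'
    obtain ⟨f₀, f₁, hf₀m, hf₁m, hf, hf₀, hf₁⟩ := hc (fun x => l⁻¹ * ‖f x‖₊)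
      (fun x => ‖g₀ x‖₊) (fun x => ‖g₁ x‖₊)
      (f.stronglyMeasurable.measurable.nnnorm.const_mul _)
      g₀.stronglyMeasurable.measurable.nnnorm g₁.stronglyMeasurable.measurable.nnnorm
      (dominated_enorm (by simpa using hg₀)) (dominated_enorm (by simpa using hg₁)) (by
        filter_upwards [hh, hle] with x h1 h2
        have := cesaroAvg_const_mul (μ := μ) (p := p) l⁻¹ (fun x => ‖f x‖ₑ) x
        simp only [ENNReal.coe_mul]
        change cesaroAvg μ p (fun y => (l⁻¹ : ℝ≥0) * ‖f y‖ₑ) x ≤ _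
        rw [this]
        calc ((l⁻¹ : ℝ≥0) : ℝ≥0∞) * cesaroAvg μ p (fun x => ‖f x‖ₑ) x
            ≤ (l⁻¹ : ℝ≥0) * ((l * φ (‖g₀ x‖₊, ‖g₁ x‖₊) : ℝ≥0) : ℝ≥0∞) := by
              gcongr
              exact h1.trans (by exact_mod_cast h2)
          _ = _ := by
              rw [← ENNReal.coe_mul, inv_mul_cancel_left₀ hl'])
    have hel : ∀ F : α → ℝ≥0, Measurable F → ∃ G : α →ₘ[μ] ℝ, ∀ᵐ x ∂μ, ‖G x‖₊ = (c + 1)⁻¹ * F x := by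
      intro F hF
      obtain ⟨G, hG⟩ := exists_enorm_eq (μ := μ) (g := fun x => (((c + 1)⁻¹ * F x : ℝ≥0) : ℝ≥0∞))
        (hF.const_mul _).coe_nnreal_ennreal (ae_of_all _ fun x => ENNReal.coe_lt_top)
      exact ⟨G, hG.mono fun x hx => by rwa [enorm_eq_nnnorm, ENNReal.coe_inj] at hx⟩
    obtain ⟨G₀, hG₀⟩ := hel f₀ hf₀m
    obtain ⟨G₁, hG₁⟩ := hel f₁ hf₁m
    have hnorm : ∀ {N' M' : (α →ₘ[μ] ℝ) → ℝ≥0∞} (_ : IsBanachIdeal N') (_ : IsCesaroNorm p N' M')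
        {F : α → ℝ≥0} {G : α →ₘ[μ] ℝ} (_ : ∀ᵐ x ∂μ, ‖G x‖₊ = (c + 1)⁻¹ * F x)
        (_ : Dominated N' c (cesaroAvg μ p fun x => F x)), M' G ≤ 1 := by
      intro N' M' hN' hM' F G hG hF
      have := (hM' G 1).2 ((hF.const_mul hN' (c + 1)⁻¹).mono ?_ (ae_of_all _ fun y => ?_))
      · simpa using this
      · rw [inv_mul_le_iff₀ (by positivity), mul_one]
        exact le_self_add
      · rw [← cesaroAvg_const_mul]
        refine cesaroAvg_le_cesaroAvg ?_ y
        filter_upwards [hG] with x hx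
        rw [enorm_eq_nnnorm, hx, ENNReal.coe_mul]
    calc calderonLozanovskii φ M₀ M₁ f ≤ (((c + 1) * l : ℝ≥0) : ℝ≥0∞) := by
          refine iInf₂_le ((c + 1) * l) ⟨by positivity, G₀, G₁, hnorm hN₀ h₀ hG₀ hf₀,
            hnorm hN₁ h₁ hG₁ hf₁, ?_⟩
          filter_upwards [hf, hG₀, hG₁] with x h1 h2 h3
          rw [h2, h3, hφ.1]
          rw [inv_mul_le_iff₀ hl0] at h1
          calc ‖f x‖₊ ≤ l * φ (f₀ x, f₁ x) := h1
            _ = _ := by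
              rw [mul_comm (c + 1) l, mul_assoc, mul_inv_cancel_left₀ hc1]
      _ ≤ (((c + 1) * (k + ε / (c + 1)) : ℝ≥0) : ℝ≥0∞) := by
          rw [ENNReal.coe_le_coe]
          have : l ≤ k + ε / (c + 1) := by exact_mod_cast hl.le
          gcongr
      _ = ((c + 1 : ℝ≥0) : ℝ≥0∞) * k + ε := by
          rw [mul_add, mul_div_cancel₀ _ hc1]
          push_cast; rfl
  have hA : ∀ f, calderonLozanovskii φ M₀ M₁ f ≤ ((c + 2 : ℝ≥0) : ℝ≥0∞) * M f ∧
      M f ≤ ((c + 2 : ℝ≥0) : ℝ≥0∞) * calderonLozanovskii φ M₀ M₁ f := by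
    refine fun f => ⟨(hbwd f).trans ?_, (hfwd f).trans ?_⟩
    · gcongr
      norm_num
    · gcongr
      exact_mod_cast (le_add_self : (2 : ℝ≥0) ≤ c + 2)
  refine ⟨Set.ext fun f => ⟨fun hf => ?_, fun hf => ?_⟩, c + 2, by positivity, fun f _ => hA f⟩
  · exact (hA f).2.trans_lt (ENNReal.mul_lt_top ENNReal.coe_lt_top hf)
  · exact (hA f).1.trans_lt (ENNReal.mul_lt_top ENNReal.coe_lt_top hf)

end Reduction

/-! ### Block decomposition -/

section Blocks

variable {α : Type*} [MeasurableSpace α] {μ : Measure α} {p : α → ℝ}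

/-- The index `k ∈ ℤ` of the block `(τᵏ⁺¹, τᵏ]` that contains `x > 0`. -/
noncomputable def blockIndex (τ x : ℝ) : ℤ := ⌊Real.log x / Real.log τ⌋

theorem measurable_blockIndex (τ : ℝ) : Measurable (blockIndex τ) :=
  (Real.measurable_log.div_const _).floor

theorem blockIndex_eq_iff {τ : ℝ} (h0 : 0 < τ) (h1 : τ < 1) {x : ℝ} (hx : 0 < x) (k : ℤ) :
    blockIndex τ x = k ↔ τ ^ (k + 1) < x ∧ x ≤ τ ^ k := by
  have hl : Real.log τ < 0 := Real.log_neg h0 h1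
  rw [blockIndex, Int.floor_eq_iff, le_div_iff_of_neg hl, div_lt_iff_of_neg hl,
    ← Real.log_le_log_iff hx (by positivity), ← Real.log_lt_log_iff (by positivity) hx,
    Real.log_zpow, Real.log_zpow]
  push_cast
  exact and_comm

/-- On the block `τᵏ⁺¹ < p ≤ τᵏ` the decomposition is
`fᵢ = f · Vᵢ(τᵏ⁻¹) / φ(V₀(τᵏ⁻¹), V₁(τᵏ⁻¹))`. The coefficient being constant on the block,
`φ(f₀, f₁) = f` by homogeneity, while `fᵢ` has mass at most `Vᵢ(τᵏ⁻¹)` on the block. These masses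
are summed by means of the disjoint sets `τᵏ⁻¹ < p ≤ τᵏ⁻²`. -/
theorem exists_block_decomposition {φ : ℝ≥0 × ℝ≥0 → ℝ≥0} (hφ : ClassU φ) (hp : Measurable p)
    (hp0 : ∀ᵐ x ∂μ, 0 < p x) {τ : ℝ} (h0 : 0 < τ) (h1 : τ < 1) {f : α → ℝ≥0} (hf : Measurable f)
    {V₀ V₁ : ℝ → ℝ≥0} {w₀ w₁ : α → ℝ≥0∞}
    (hF : ∀ x > 0, cumul μ p (fun y => f y) (τ * x) ≤ φ (V₀ x, V₁ x))
    (hV₀ : ∀ x > 0, V₀ x ≤ ∫⁻ y in {y | x < p y ∧ p y ≤ x / τ}, w₀ y ∂μ)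
    (hV₁ : ∀ x > 0, V₁ x ≤ ∫⁻ y in {y | x < p y ∧ p y ≤ x / τ}, w₁ y ∂μ) :
    ∃ f₀ f₁ : α → ℝ≥0, Measurable f₀ ∧ Measurable f₁ ∧ (∀ᵐ x ∂μ, f x ≤ φ (f₀ x, f₁ x)) ∧
      (∀ x > 0, cumul μ p (fun y => f₀ y) x ≤ cumul μ p w₀ (x / τ ^ 3)) ∧
      (∀ x > 0, cumul μ p (fun y => f₁ y) x ≤ cumul μ p w₁ (x / τ ^ 3)) := by
  set κ : α → ℤ := fun y => blockIndex τ (p y) with hκ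
  have hκm : Measurable κ := (measurable_blockIndex τ).comp hp
  have hBm : ∀ k, MeasurableSet (κ ⁻¹' {k}) := fun k => hκm (measurableSet_singleton k)
  set Φ : ℤ → ℝ≥0 := fun k => φ (V₀ (τ ^ (k - 1)), V₁ (τ ^ (k - 1))) with hΦ
  have hpow : ∀ k : ℤ, (0 : ℝ) < τ ^ k := fun k => zpow_pos h0 k
  have hBf : ∀ k, ∫⁻ y in κ ⁻¹' {k}, f y ∂μ ≤ Φ k := by
    intro k
    refine le_trans ?_ (hF (τ ^ (k - 1)) (hpow _))
    refine lintegral_mono_set' ?_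
    filter_upwards [hp0] with y hy hyk
    have := ((blockIndex_eq_iff h0 h1 hy k).1 hyk).2
    change p y ≤ τ * τ ^ (k - 1)
    rwa [← zpow_one_add₀ h0.ne', add_sub_cancel]
  have hz : ∀ᵐ y ∂μ, Φ (κ y) = 0 → f y = 0 := by
    have : ∀ k, ∀ᵐ y ∂μ, κ y = k → Φ k = 0 → f y = 0 := by
      intro k
      by_cases hk : Φ k = 0
      · have h2 := hBf k
        rw [hk, ENNReal.coe_zero, nonpos_iff_eq_zero,
          lintegral_eq_zero_iff hf.coe_nnreal_ennreal] at h2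
        have h3 := (ae_restrict_iff' (hBm k)).1 h2
        filter_upwards [h3] with y hy hyk _
        simpa using hy hyk
      · exact ae_of_all _ fun y _ h => absurd h hk
    filter_upwards [ae_all_iff.2 this] with y hy using hy _ rfl
  have hmeas : ∀ V : ℝ → ℝ≥0, Measurable fun y => f y * (V (τ ^ (κ y - 1)) / Φ (κ y)) := fun V =>
    hf.mul ((measurable_of_countable fun k : ℤ => V (τ ^ (k - 1)) / Φ k).comp hκm)
  have hcum : ∀ (V : ℝ → ℝ≥0) (w : α → ℝ≥0∞),
      (∀ x > 0, V x ≤ ∫⁻ y in {y | x < p y ∧ p y ≤ x / τ}, w y ∂μ) → ∀ x > 0,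
      cumul μ p (fun y => ((f y * (V (τ ^ (κ y - 1)) / Φ (κ y)) : ℝ≥0) : ℝ≥0∞)) x
        ≤ cumul μ p w (x / τ ^ 3) := by
    intro V w hV x hx
    have hsum : ∀ (g : α → ℝ≥0∞) (x : ℝ), cumul μ p g x
        = ∑' k, ∫⁻ y in κ ⁻¹' {k} ∩ {y | p y ≤ x}, g y ∂μ := by
      intro g x
      have hU : (⋃ k, κ ⁻¹' {k}) = univ := by
        ext y
        simp
      have := lintegral_iUnion (μ := μ.restrict {y | p y ≤ x}) hBm
        (fun i j hij => (disjoint_singleton.2 hij).preimage κ) g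
      rw [hU, Measure.restrict_univ] at this
      rw [cumul, this]
      refine tsum_congr fun k => ?_
      rw [Measure.restrict_restrict (hBm k)]
    rw [hsum, hsum, ← (Equiv.subRight (2 : ℤ)).tsum_eq
      (fun k => ∫⁻ y in κ ⁻¹' {k} ∩ {y | p y ≤ x / τ ^ 3}, w y ∂μ)]
    refine ENNReal.tsum_le_tsum fun k => ?_
    rw [Equiv.subRight_apply]
    by_cases hk : τ ^ (k + 1) < x
    · calc ∫⁻ y in κ ⁻¹' {k} ∩ {y | p y ≤ x}, ((f y * (V (τ ^ (κ y - 1)) / Φ (κ y)) : ℝ≥0) : ℝ≥0∞) ∂μ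
          ≤ ∫⁻ y in κ ⁻¹' {k}, ((f y * (V (τ ^ (κ y - 1)) / Φ (κ y)) : ℝ≥0) : ℝ≥0∞) ∂μ :=
            lintegral_mono_set inter_subset_left
        _ = ∫⁻ y in κ ⁻¹' {k}, ((V (τ ^ (k - 1)) / Φ k : ℝ≥0) : ℝ≥0∞) * f y ∂μ := by
            refine setLIntegral_congr_fun (hBm k) fun y hy => ?_
            have hy : κ y = k := hy
            simp only [hy]
            rw [mul_comm, ENNReal.coe_mul]
        _ = ((V (τ ^ (k - 1)) / Φ k : ℝ≥0) : ℝ≥0∞) * ∫⁻ y in κ ⁻¹' {k}, f y ∂μ :=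
            lintegral_const_mul' _ _ ENNReal.coe_ne_top
        _ ≤ ((V (τ ^ (k - 1)) / Φ k : ℝ≥0) : ℝ≥0∞) * Φ k := by
            gcongr
            exact hBf k
        _ ≤ V (τ ^ (k - 1)) := by
            rw [← ENNReal.coe_mul, ENNReal.coe_le_coe]
            rcases eq_or_ne (Φ k) 0 with h | h
            · rw [h, mul_zero]; exact zero_le
            · rw [div_mul_cancel₀ _ h]
        _ ≤ ∫⁻ y in {y | τ ^ (k - 1) < p y ∧ p y ≤ τ ^ (k - 1) / τ}, w y ∂μ := hV _ (hpow _)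
        _ ≤ ∫⁻ y in κ ⁻¹' {k - 2} ∩ {y | p y ≤ x / τ ^ 3}, w y ∂μ := by
            have e1 : τ ^ (k - 1) / τ = τ ^ (k - 2) := by
              rw [div_eq_mul_inv, ← zpow_sub_one₀ h0.ne']; congr 1; ring
            have e2 : τ ^ (k - 2) = τ ^ (k + 1) / τ ^ 3 := by
              rw [← zpow_natCast τ 3, ← zpow_sub₀ h0.ne']; congr 1; push_cast; ring
            refine lintegral_mono_set fun y hy => ⟨?_, ?_⟩
            · refine (blockIndex_eq_iff h0 h1 ((hpow _).trans hy.1) _).2 ⟨?_, ?_⟩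
              · convert hy.1 using 2; ring
              · exact hy.2.trans e1.le
            · refine (hy.2.trans (e1.trans e2).le).trans ?_
              gcongr
    · have : μ (κ ⁻¹' {k} ∩ {y | p y ≤ x}) = 0 := by
        refine measure_mono_null ?_ (ae_iff.1 hp0)
        intro y hy hpos
        exact hk (((blockIndex_eq_iff h0 h1 hpos k).1 hy.1).1.trans_le hy.2)
      rw [setLIntegral_measure_zero _ _ this]
      exact zero_le
  refine ⟨_, _, hmeas V₀, hmeas V₁, ?_, hcum V₀ w₀ hV₀, hcum V₁ w₁ hV₁⟩
  filter_upwards [hz] with y hy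
  by_cases hΦ0 : Φ (κ y) = 0
  · rw [hy hΦ0]; exact zero_le
  · have e : φ (f y * (V₀ (τ ^ (κ y - 1)) / Φ (κ y)), f y * (V₁ (τ ^ (κ y - 1)) / Φ (κ y)))
        = f y * ((Φ (κ y))⁻¹ * Φ (κ y)) := by
      rw [hφ.1, div_eq_inv_mul, div_eq_inv_mul, hφ.1]
    rw [e, inv_mul_cancel₀ hΦ0, mul_one]

/-- A monotone function `u` is controlled by an average of `u / p` over the block following `x`,
if this block has mass at least proportional to `x`. -/
theorem le_setLIntegral_div {τ c : ℝ} (hτ : 0 < τ) (hc : 0 < c) (hp : Measurable p)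
    {u : ℝ → ℝ≥0∞} (hu : Monotone u) {x : ℝ} (hx : 0 < x)
    (hmass : ENNReal.ofReal (c * x) ≤ μ {y | x < p y ∧ p y ≤ x / τ}) :
    u x ≤ ENNReal.ofReal (1 / (c * τ)) *
      ∫⁻ y in {y | x < p y ∧ p y ≤ x / τ}, u (p y) / ENNReal.ofReal (p y) ∂μ := by
  have hm : MeasurableSet {y | x < p y ∧ p y ≤ x / τ} :=
    (measurableSet_lt measurable_const hp).inter (measurableSet_le hp measurable_const)
  calc u x = ENNReal.ofReal (1 / (c * τ)) *
      (u x / ENNReal.ofReal (x / τ) * ENNReal.ofReal (c * x)) := by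
        rw [div_eq_mul_inv (u x), mul_assoc, mul_left_comm, ← ENNReal.ofReal_inv_of_pos (by positivity),
          ← ENNReal.ofReal_mul (by positivity), ← ENNReal.ofReal_mul (by positivity)]
        have : 1 / (c * τ) * ((x / τ)⁻¹ * (c * x)) = 1 := by field_simp
        rw [this, ENNReal.ofReal_one, mul_one]
    _ ≤ ENNReal.ofReal (1 / (c * τ)) *
      ∫⁻ y in {y | x < p y ∧ p y ≤ x / τ}, u x / ENNReal.ofReal (x / τ) ∂μ := by
        rw [setLIntegral_const]
        gcongr
    _ ≤ _ := by
        refine mul_le_mul_right (setLIntegral_mono' hm fun y hy => ?_) _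
        exact ENNReal.div_le_div (hu hy.1.le) (ENNReal.ofReal_le_ofReal hy.2)

end Blocks

/-! ### Decomposition when a contracting dilation is bounded -/

section Dilation

variable {α : Type*} [MeasurableSpace α] {μ : Measure α} {p : α → ℝ}

/-- The operator `T` on nonnegative functions is bounded on the space with norm `N`. -/
def PosBounded (N : (α →ₘ[μ] ℝ) → ℝ≥0∞) (T : (α → ℝ≥0∞) → α → ℝ≥0∞) : Prop :=
  ∃ K : ℝ≥0, ∀ (k : ℝ≥0) (g : α → ℝ≥0∞), Dominated N k g → Dominated N (K * k) (T g)

theorem PosBounded.comp {N : (α →ₘ[μ] ℝ) → ℝ≥0∞} {T S : (α → ℝ≥0∞) → α → ℝ≥0∞}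
    (hT : PosBounded N T) (hS : PosBounded N S) : PosBounded N (fun g => T (S g)) := by
  obtain ⟨K, hK⟩ := hT
  obtain ⟨L, hL⟩ := hS
  exact ⟨K * L, fun k g hg => by rw [mul_assoc]; exact hK _ _ (hL _ _ hg)⟩

theorem PosBounded.const_mul {N : (α →ₘ[μ] ℝ) → ℝ≥0∞} (hN : IsBanachIdeal N)
    {T : (α → ℝ≥0∞) → α → ℝ≥0∞} (hT : PosBounded N T) (c : ℝ≥0) :
    PosBounded N (fun g y => c * T g y) := by
  obtain ⟨K, hK⟩ := hT
  exact ⟨c * K, fun k g hg => by rw [mul_assoc]; exact (hK _ _ hg).const_mul hN c⟩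

theorem PosBounded.add {N : (α →ₘ[μ] ℝ) → ℝ≥0∞} (hN : IsBanachIdeal N)
    {T S : (α → ℝ≥0∞) → α → ℝ≥0∞} (hT : PosBounded N T) (hS : PosBounded N S) :
    PosBounded N (fun g y => T g y + S g y) := by
  obtain ⟨K, hK⟩ := hT
  obtain ⟨L, hL⟩ := hS
  exact ⟨K + L, fun k g hg => by rw [add_mul]; exact (hK _ _ hg).add hN (hL _ _ hg)⟩

theorem PosBounded.mono {N : (α →ₘ[μ] ℝ) → ℝ≥0∞} {T S : (α → ℝ≥0∞) → α → ℝ≥0∞}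
    (hT : PosBounded N T) (h : ∀ g, ∀ᵐ y ∂μ, S g y ≤ T g y) : PosBounded N S := by
  obtain ⟨K, hK⟩ := hT
  exact ⟨K, fun k g hg => (hK k g hg).mono le_rfl (h g)⟩

theorem cumul_ne_top (hp : ∀ x, μ {y | x < p y} ≠ 0) {g : α → ℝ≥0∞}
    (h : ∀ᵐ y ∂μ, cesaroAvg μ p g y < ∞) (x : ℝ) : cumul μ p g x ≠ ∞ := by
  have : ∃ y, x < p y ∧ cesaroAvg μ p g y < ∞ := by
    by_contra hc
    push Not at hc
    exact hp x (measure_mono_null (fun y hy => not_lt.2 (hc y hy)) (ae_iff.1 h))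
  obtain ⟨y, hxy, hy⟩ := this
  exact ((cumul_mono g hxy.le).trans_lt (cumul_lt_top hy)).ne

/-- The decomposition at the level of cumulated masses, when the blocks `x < p ≤ x / τ` have mass
proportional to `x`. The hypothesis `hF` is the bound on `f` in terms of the monotone functions
`x ↦ ∫_{p ≤ x} gᵢ`. -/
theorem exists_decomposition_of_cumul_le {φ : ℝ≥0 × ℝ≥0 → ℝ≥0} (hφ : ClassU φ) (hp : Measurable p)
    (hp0 : ∀ᵐ x ∂μ, 0 < p x) {τ c : ℝ} (h0 : 0 < τ) (h1 : τ < 1) (hc : 0 < c)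
    (hmass : ∀ x > 0, μ {y | p y ≤ x} ≠ 0 → ENNReal.ofReal (c * x) ≤ μ {y | x < p y ∧ p y ≤ x / τ})
    {A : ℝ≥0} {f : α → ℝ≥0} (hf : Measurable f) {g₀ g₁ : α → ℝ≥0∞}
    (hg₀ : ∀ x, cumul μ p g₀ x ≠ ∞) (hg₁ : ∀ x, cumul μ p g₁ x ≠ ∞)
    (hF : ∀ x > 0, cumul μ p (fun y => f y) (τ * x)
      ≤ A * φ ((cumul μ p g₀ x).toNNReal, (cumul μ p g₁ x).toNNReal)) :
    ∃ f₀ f₁ : α → ℝ≥0, Measurable f₀ ∧ Measurable f₁ ∧ (∀ᵐ x ∂μ, f x ≤ φ (f₀ x, f₁ x)) ∧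
      (∀ x > 0, cumul μ p (fun y => f₀ y) x
        ≤ (A * (1 / (c * τ)).toNNReal : ℝ≥0) * cumul μ p (cesaroAvg μ p g₀) (x / τ ^ 3)) ∧
      (∀ x > 0, cumul μ p (fun y => f₁ y) x
        ≤ (A * (1 / (c * τ)).toNNReal : ℝ≥0) * cumul μ p (cesaroAvg μ p g₁) (x / τ ^ 3)) := by
  have hV : ∀ g : α → ℝ≥0∞, (∀ x, cumul μ p g x ≠ ∞) → ∀ x > 0,
      ((A * (cumul μ p g x).toNNReal : ℝ≥0) : ℝ≥0∞) ≤ ∫⁻ y in {y | x < p y ∧ p y ≤ x / τ},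
        (A * (1 / (c * τ)).toNNReal : ℝ≥0) * cesaroAvg μ p g y ∂μ := by
    intro g hg x hx
    rw [lintegral_const_mul' _ _ ENNReal.coe_ne_top, ENNReal.coe_mul, ENNReal.coe_mul,
      ENNReal.coe_toNNReal (hg x), mul_assoc]
    refine mul_le_mul_right ?_ _
    by_cases h : μ {y | p y ≤ x} = 0
    · rw [cumul, setLIntegral_measure_zero _ _ h]
      exact zero_le
    · exact le_setLIntegral_div h0 hc hp (cumul_mono g) hx (hmass x hx h)
  obtain ⟨f₀, f₁, m₀, m₁, hle, h₀, h₁⟩ := exists_block_decomposition hφ hp hp0 h0 h1 hf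
    (V₀ := fun x => A * (cumul μ p g₀ x).toNNReal) (V₁ := fun x => A * (cumul μ p g₁ x).toNNReal)
    (fun x hx => by rw [hφ.1]; exact_mod_cast hF x hx) (hV g₀ hg₀) (hV g₁ hg₁)
  refine ⟨f₀, f₁, m₀, m₁, hle, fun x hx => (h₀ x hx).trans_eq ?_, fun x hx => (h₁ x hx).trans_eq ?_⟩
  · rw [cumul_const_mul]
  · rw [cumul_const_mul]

/-- If `Cf ≤ φ(g₀, g₁)`, then averaging once more gives a bound for `∫_{p ≤ τ x} f` in terms of
`∫_{p ≤ x} gᵢ`. -/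
theorem cumul_mul_le {φ : ℝ≥0 × ℝ≥0 → ℝ≥0} (hφ : ClassU φ) (hp : Measurable p)
    {τ c : ℝ} (h0 : 0 < τ) (hc : 0 < c) {x : ℝ} (hx : 0 < x)
    (hmass : μ {y | p y ≤ τ * x} ≠ 0 →
      ENNReal.ofReal (c * (τ * x)) ≤ μ {y | τ * x < p y ∧ p y ≤ x})
    {f : α → ℝ≥0∞} {g₀ g₁ : α → ℝ≥0} (m₀ : Measurable g₀) (m₁ : Measurable g₁)
    (hg₀ : cumul μ p (fun y => g₀ y) x ≠ ∞) (hg₁ : cumul μ p (fun y => g₁ y) x ≠ ∞)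
    (hf : ∀ᵐ y ∂μ, p y ≤ x → cesaroAvg μ p f y ≤ φ (g₀ y, g₁ y)) :
    cumul μ p f (τ * x) ≤ (2 * (1 / (c * τ)).toNNReal : ℝ≥0) *
      φ ((cumul μ p (fun y => g₀ y) x).toNNReal, (cumul μ p (fun y => g₁ y) x).toNNReal) := by
  by_cases h : μ {y | p y ≤ τ * x} = 0
  · rw [cumul, setLIntegral_measure_zero _ _ h]
    exact zero_le
  have e : τ * x / τ = x := by field_simp
  calc cumul μ p f (τ * x)
      ≤ ENNReal.ofReal (1 / (c * τ)) *
        ∫⁻ y in {y | τ * x < p y ∧ p y ≤ τ * x / τ}, cesaroAvg μ p f y ∂μ :=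
        le_setLIntegral_div h0 hc hp (cumul_mono f) (by positivity) (by rw [e]; exact hmass h)
    _ ≤ ENNReal.ofReal (1 / (c * τ)) * ∫⁻ y in {y | p y ≤ x}, φ (g₀ y, g₁ y) ∂μ := by
        rw [e]
        refine mul_le_mul_right ?_ _
        refine (lintegral_mono_set (t := {y | p y ≤ x}) fun y hy => hy.2).trans ?_
        refine lintegral_mono_ae ?_
        rw [ae_restrict_iff' (measurableSet_le hp measurable_const)]
        exact hf
    _ ≤ ENNReal.ofReal (1 / (c * τ)) * (2 * φ ((cumul μ p (fun y => g₀ y) x).toNNReal,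
          (cumul μ p (fun y => g₁ y) x).toNNReal)) := by
        refine mul_le_mul_right ?_ _
        exact hφ.lintegral_le m₀.aemeasurable m₁.aemeasurable (ENNReal.coe_toNNReal hg₀).ge
          (ENNReal.coe_toNNReal hg₁).ge
    _ = _ := by
        rw [ENNReal.ofReal]
        push_cast
        ring

/-- The decomposition property on `[0, ∞)` and on `ℕ`: here `C fᵢ` is controlled by the iterated
average `CC gᵢ`, evaluated at a point whose position is larger by the factor `τ⁻³`. -/
theorem hasDecomposition_of_dilation {φ : ℝ≥0 × ℝ≥0 → ℝ≥0} (hφ : ClassU φ) (hp : Measurable p)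
    (hp0 : ∀ᵐ x ∂μ, 0 < p x) (hp' : ∀ x, μ {y | x < p y} ≠ 0)
    {τ c : ℝ} (h0 : 0 < τ) (h1 : τ < 1) (hc : 0 < c)
    (hmass : ∀ x > 0, μ {y | p y ≤ x} ≠ 0 → ENNReal.ofReal (c * x) ≤ μ {y | x < p y ∧ p y ≤ x / τ})
    {δ : α → α} (hδ : ∀ y, p (δ y) = p y / τ) {N₀ N₁ : (α →ₘ[μ] ℝ) → ℝ≥0∞}
    (hN₀ : IsBanachIdeal N₀) (hN₁ : IsBanachIdeal N₁)
    (hC₀ : PosBounded N₀ (cesaroAvg μ p)) (hC₁ : PosBounded N₁ (cesaroAvg μ p))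
    (hD₀ : PosBounded N₀ (fun g y => g (δ y))) (hD₁ : PosBounded N₁ (fun g y => g (δ y))) :
    HasDecomposition p φ N₀ N₁ := by
  set A : ℝ≥0 := 2 * (1 / (c * τ)).toNNReal with hA
  set B : ℝ≥0 := A * (1 / (c * τ)).toNNReal with hB
  set R : ℝ≥0 := ((τ ^ 3)⁻¹).toNNReal with hR
  -- the composition of operators that controls `C fᵢ`
  have hop : ∀ {N : (α →ₘ[μ] ℝ) → ℝ≥0∞}, IsBanachIdeal N → PosBounded N (cesaroAvg μ p) →
      PosBounded N (fun g y => g (δ y)) → PosBounded N (fun g y => (B * R : ℝ≥0) *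
        cesaroAvg μ p (cesaroAvg μ p g) (δ (δ (δ y)))) := fun hN hC hD =>
    PosBounded.const_mul hN (hD.comp (hD.comp (hD.comp (hC.comp hC)))) (B * R)
  obtain ⟨K₀, hK₀⟩ := hop hN₀ hC₀ hD₀
  obtain ⟨K₁, hK₁⟩ := hop hN₁ hC₁ hD₁
  have hfin : ∀ {N : (α →ₘ[μ] ℝ) → ℝ≥0∞}, PosBounded N (cesaroAvg μ p) → ∀ {g : α → ℝ≥0∞},
      Dominated N 1 g → ∀ x, cumul μ p g x ≠ ∞ := by
    intro N hC g hg
    obtain ⟨K, hK⟩ := hC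
    exact cumul_ne_top hp' (hK _ _ hg).lt_top
  refine ⟨max K₀ K₁, fun f g₀ g₁ hf m₀ m₁ hg₀ hg₁ hle => ?_⟩
  obtain ⟨f₀, f₁, n₀, n₁, hff, e₀, e₁⟩ := exists_decomposition_of_cumul_le hφ hp hp0 h0 h1 hc hmass
    (A := A) hf (hfin hC₀ hg₀) (hfin hC₁ hg₁) (fun x hx => cumul_mul_le hφ hp h0 hc hx
      (fun h => by
        have := hmass (τ * x) (by positivity) h
        rwa [mul_div_cancel_left₀ _ h0.ne'] at this) m₀ m₁ (hfin hC₀ hg₀ x) (hfin hC₁ hg₁ x)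
      (hle.mono fun y hy _ => hy))
  have hfinal : ∀ {f : α → ℝ≥0} {g : α → ℝ≥0∞}, (∀ x > 0, cumul μ p (fun y => f y) x
      ≤ B * cumul μ p (cesaroAvg μ p g) (x / τ ^ 3)) → ∀ᵐ y ∂μ, cesaroAvg μ p (fun y => f y) y
      ≤ (B * R : ℝ≥0) * cesaroAvg μ p (cesaroAvg μ p g) (δ (δ (δ y))) := by
    intro f g h
    filter_upwards [hp0] with y hy
    have e : p (δ (δ (δ y))) = p y / τ ^ 3 := by rw [hδ, hδ, hδ]; field_simp
    rw [cesaroAvg, cesaroAvg, e]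
    refine (ENNReal.div_le_div_right (h _ hy) _).trans_eq ?_
    rw [ENNReal.coe_mul B R, mul_div_assoc, mul_assoc]
    congr 1
    generalize cumul μ p (cesaroAvg μ p g) (p y / τ ^ 3) = Z
    have hRR : ((R : ℝ≥0) : ℝ≥0∞) * (ENNReal.ofReal (τ ^ 3)⁻¹)⁻¹ = 1 :=
      ENNReal.mul_inv_cancel (by simpa [hR] using pow_pos h0 3) ENNReal.coe_ne_top
    rw [div_eq_mul_inv (p y), ENNReal.ofReal_mul hy.le, div_eq_mul_inv, div_eq_mul_inv,
      ENNReal.mul_inv (by simp [hy]) (by simp)]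
    calc Z * (ENNReal.ofReal (p y))⁻¹
        = Z * (ENNReal.ofReal (p y))⁻¹ * (R * (ENNReal.ofReal (τ ^ 3)⁻¹)⁻¹) := by rw [hRR, mul_one]
      _ = _ := by ring
  refine ⟨f₀, f₁, n₀, n₁, hff, (hK₀ _ _ hg₀).mono ?_ (hfinal e₀), (hK₁ _ _ hg₁).mono ?_ (hfinal e₁)⟩
  · rw [mul_one]; exact le_max_left _ _
  · rw [mul_one]; exact le_max_right _ _

end Dilation

/-! ### Cesàro spaces on intervals -/

section Interval

variable {I : Set ℝ}

theorem cumul_restrict (hI0 : I ⊆ Ici 0) {x : ℝ} (hx : Ioc 0 x ⊆ I)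
    (g : ℝ → ℝ≥0∞) : cumul (volume.restrict I) (fun y => y) g x = ∫⁻ y in Ioc 0 x, g y := by
  have hm : MeasurableSet {y : ℝ | y ≤ x} := measurableSet_Iic
  rw [cumul, Measure.restrict_restrict hm]
  refine setLIntegral_congr ?_
  have h0 : ∀ᵐ y : ℝ, y ≠ 0 := by simp [ae_iff]
  filter_upwards [h0] with y hy
  refine propext ⟨fun h => ⟨lt_of_le_of_ne (hI0 h.2) hy.symm, h.1⟩, fun h => ⟨h.2, hx h⟩⟩

theorem ae_restrict_pos (hI : MeasurableSet I) (hI0 : I ⊆ Ici 0) :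
    ∀ᵐ x ∂(volume.restrict I), x ∈ I ∧ (0 : ℝ) < x := by
  have h0 : ∀ᵐ y : ℝ, y ≠ 0 := by simp [ae_iff]
  rw [ae_restrict_iff' hI]
  filter_upwards [h0] with y hy hyI
  exact ⟨hyI, lt_of_le_of_ne (hI0 hyI) hy.symm⟩

/-- At each point `x > 0` of `I`: the Bochner integral defining `C|f|(x)` exists if and only if the
`[0, ∞]`-valued average is finite, and in that case the two agree. -/
theorem cesaro_abs_spec (hI0 : I ⊆ Ici 0)
    (hI1 : ∀ x ∈ I, Ioc 0 x ⊆ I) (f : ℝ →ₘ[volume.restrict I] ℝ) {x : ℝ} (hxI : x ∈ I)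
    (hx : 0 < x) :
    (IntervalIntegrable (fun t => |f| t) volume 0 x ↔
      cesaroAvg (volume.restrict I) (fun y => y) (fun y => ‖f y‖ₑ) x < ∞) ∧
    (cesaroAvg (volume.restrict I) (fun y => y) (fun y => ‖f y‖ₑ) x < ∞ →
      ‖(1 / x) * ∫ t in (0 : ℝ)..x, |f| t‖ₑ =
        cesaroAvg (volume.restrict I) (fun y => y) (fun y => ‖f y‖ₑ) x) := by
  have habs : ∀ᵐ y ∂(volume.restrict (Ioc 0 x)), |f| y = ‖f y‖ :=
    ae_mono (Measure.restrict_mono (hI1 x hxI) le_rfl) (AEEqFun.coeFn_abs f)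
  have hc := cumul_restrict hI0 (hI1 x hxI) (fun y => ‖f y‖ₑ)
  have hx' : ENNReal.ofReal x ≠ 0 := by simpa using hx
  have hmeas : AEStronglyMeasurable f (volume.restrict (Ioc 0 x)) :=
    f.stronglyMeasurable.aestronglyMeasurable
  have hint : cesaroAvg (volume.restrict I) (fun y => y) (fun y => ‖f y‖ₑ) x < ∞ ↔
      IntegrableOn f (Ioc 0 x) volume := by
    rw [IntegrableOn, Integrable, hasFiniteIntegral_iff_enorm, ← hc]
    exact ⟨fun h => ⟨hmeas, cumul_lt_top h⟩, fun h => ENNReal.div_lt_top h.2.ne hx'⟩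
  refine ⟨?_, fun h => ?_⟩
  · rw [intervalIntegrable_iff_integrableOn_Ioc_of_le hx.le, hint]
    refine (integrable_congr habs).trans ?_
    exact integrable_norm_iff hmeas
  · rw [intervalIntegral.integral_of_le hx.le, integral_congr_ae habs, enorm_mul,
      Real.enorm_of_nonneg (integral_nonneg fun _ => norm_nonneg _),
      ofReal_integral_norm_eq_lintegral_enorm (hint.1 h), ← hc, Real.enorm_of_nonneg (by positivity),
      one_div, ENNReal.ofReal_inv_of_pos hx, cesaroAvg, div_eq_mul_inv, mul_comm]

theorem enorm_cesaro_abs (hI : MeasurableSet I) (hI0 : I ⊆ Ici 0)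
    (hI1 : ∀ x ∈ I, Ioc 0 x ⊆ I) (f : ℝ →ₘ[volume.restrict I] ℝ)
    (hf : ∀ᵐ x ∂(volume.restrict I),
      cesaroAvg (volume.restrict I) (fun y => y) (fun y => ‖f y‖ₑ) x < ∞) :
    ∀ᵐ x ∂(volume.restrict I), ‖cesaro |f| x‖ₑ =
      cesaroAvg (volume.restrict I) (fun y => y) (fun y => ‖f y‖ₑ) x := by
  filter_upwards [hf, ae_restrict_pos hI hI0, AEEqFun.coeFn_mk _
    (stronglyMeasurable_cesaro |f|.stronglyMeasurable).aestronglyMeasurable] with x h1 h2 h3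
  rw [cesaro, h3]
  exact (cesaro_abs_spec hI0 hI1 f h2.1 h2.2).2 h1

theorem isCesaroNorm_cesaroSpace (hI : MeasurableSet I) (hI0 : I ⊆ Ici 0)
    (hI1 : ∀ x ∈ I, Ioc 0 x ⊆ I) {N : (ℝ →ₘ[volume.restrict I] ℝ) → ℝ≥0∞} (hN : IsIdealNorm N) :
    IsCesaroNorm (fun y => y) N (cesaroSpace N) := by
  intro f k
  have hdef : CesaroDefined |f| ↔ ∀ᵐ x ∂(volume.restrict I),
      cesaroAvg (volume.restrict I) (fun y => y) (fun y => ‖f y‖ₑ) x < ∞ := by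
    refine eventually_congr ?_
    filter_upwards [ae_restrict_pos hI hI0] with x hx
    exact (cesaro_abs_spec hI0 hI1 f hx.1 hx.2).1
  rw [cesaroSpace]
  split_ifs with h
  · have he := enorm_cesaro_abs hI hI0 hI1 f (hdef.1 h)
    exact ⟨fun hk => ⟨_, hk, he.mono fun x hx => hx.ge⟩,
      fun hk => Dominated.norm_le hN (hk.mono le_rfl (he.mono fun x hx => hx.le))⟩
  · exact ⟨fun hk => absurd hk (by simp), fun hk => absurd (hdef.2 hk.lt_top) h⟩

theorem posBounded_cesaroAvg (hI : MeasurableSet I) (hI0 : I ⊆ Ici 0)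
    (hI1 : ∀ x ∈ I, Ioc 0 x ⊆ I) {N : (ℝ →ₘ[volume.restrict I] ℝ) → ℝ≥0∞} (hN : IsBanachIdeal N)
    (hC : BoundedOn CesaroDefined cesaro N) :
    PosBounded N (cesaroAvg (volume.restrict I) fun y => y) := by
  obtain ⟨K, hK⟩ := hC
  refine ⟨K, fun k g hg => ?_⟩
  obtain ⟨h, hhk, hgh⟩ := hg
  have habs : N |h| ≤ N h := hN.isIdealNorm _ _ (by
    filter_upwards [AEEqFun.coeFn_abs h] with x hx
    rw [hx, Real.enorm_abs])
  obtain ⟨hD, hle⟩ := hK |h| ((habs.trans hhk).trans_lt ENNReal.coe_lt_top)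
  have hs : cesaroSpace N h ≤ ((K * k : ℝ≥0) : ℝ≥0∞) := by
    rw [cesaroSpace, if_pos hD, ENNReal.coe_mul]
    refine hle.trans ?_
    gcongr
    exact habs.trans hhk
  exact ((isCesaroNorm_cesaroSpace hI hI0 hI1 hN.isIdealNorm h _).1 hs).mono le_rfl
    (ae_of_all _ fun y => cesaroAvg_le_cesaroAvg hgh y)

end Interval

/-! ### The half-line -/

section HalfLine

theorem ae_restrict_Ici_div {τ : ℝ} (hτ : 0 < τ) {P : ℝ → Prop}
    (h : ∀ᵐ y ∂(volume.restrict (Ici (0 : ℝ))), P y) :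
    ∀ᵐ y ∂(volume.restrict (Ici (0 : ℝ))), P (y / τ) := by
  rw [ae_restrict_iff' measurableSet_Ici] at h ⊢
  rw [ae_iff] at h ⊢
  have := Real.volume_preimage_mul_right (inv_ne_zero hτ.ne') {y | ¬(y ∈ Ici (0 : ℝ) → P y)}
  rw [h, mul_zero] at this
  refine measure_mono_null (fun y hy => ?_) this
  simp only [mem_ofPred_eq, mem_preimage, Classical.not_imp, mem_Ici] at hy ⊢
  rw [div_eq_mul_inv] at hy
  exact ⟨mul_nonneg hy.1 (by positivity), hy.2⟩

theorem posBounded_dilation {N : (ℝ →ₘ[volume.restrict (Ici (0 : ℝ))] ℝ) → ℝ≥0∞} {τ : ℝ}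
    (hτ : 0 < τ) (hD : BoundedOn (fun _ => True) (dilation τ) N) :
    PosBounded N (fun g y => g (y / τ)) := by
  obtain ⟨K, hK⟩ := hD
  refine ⟨K, fun k g hg => ?_⟩
  obtain ⟨h, hhk, hgh⟩ := hg
  refine ⟨dilation τ h, (hK h (hhk.trans_lt ENNReal.coe_lt_top)).2.trans ?_, ?_⟩
  · rw [ENNReal.coe_mul]
    gcongr
  · filter_upwards [ae_restrict_Ici_div hτ hgh, AEEqFun.coeFn_mk (fun x => h (x / τ))
      (h.stronglyMeasurable.comp_measurable
        (measurable_id.div_const τ)).aestronglyMeasurable] with y h1 h2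
    rw [dilation]
    exact h1.trans_eq (congrArg _ h2.symm)

theorem volume_restrict_Ici_block {x τ : ℝ} (hx : 0 < x) :
    volume.restrict (Ici (0 : ℝ)) {y | x < y ∧ y ≤ x / τ} = ENNReal.ofReal ((1 / τ - 1) * x) := by
  have e : {y : ℝ | x < y ∧ y ≤ x / τ} = Ioc x (x / τ) := rfl
  have hsub : Ioc x (x / τ) ⊆ Ici 0 := fun y hy => hx.le.trans hy.1.le
  rw [e, Measure.restrict_apply measurableSet_Ioc, inter_eq_left.2 hsub, Real.volume_Ioc]
  congr 1
  ring

theorem spaceEq_halfLine {N₀ N₁ : (ℝ →ₘ[volume.restrict (Ici (0 : ℝ))] ℝ) → ℝ≥0∞}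
    (hN₀ : IsBanachIdeal N₀) (hN₁ : IsBanachIdeal N₁)
    (hC₀ : BoundedOn CesaroDefined cesaro N₀) (hC₁ : BoundedOn CesaroDefined cesaro N₁)
    {τ : ℝ} (hτ : 0 < τ) (hτ1 : τ < 1)
    (hD₀ : BoundedOn (fun _ => True) (dilation τ) N₀)
    (hD₁ : BoundedOn (fun _ => True) (dilation τ) N₁)
    {φ : ℝ≥0 × ℝ≥0 → ℝ≥0} (hφ : ClassU φ) :
    SpaceEq (calderonLozanovskii φ (cesaroSpace N₀) (cesaroSpace N₁))
      (cesaroSpace (calderonLozanovskii φ N₀ N₁)) := by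
  have hI1 : ∀ x ∈ Ici (0 : ℝ), Ioc 0 x ⊆ Ici 0 := fun x _ y hy => hy.1.le
  have hp0 := (ae_restrict_pos (I := Ici (0 : ℝ)) measurableSet_Ici le_rfl).mono fun _ h => h.2
  refine spaceEq_of_hasDecomposition hφ measurable_id hp0 hN₀ hN₁
    (isCesaroNorm_cesaroSpace measurableSet_Ici le_rfl hI1 hN₀.isIdealNorm)
    (isCesaroNorm_cesaroSpace measurableSet_Ici le_rfl hI1 hN₁.isIdealNorm)
    (isCesaroNorm_cesaroSpace measurableSet_Ici le_rfl hI1 isIdealNorm_calderonLozanovskii) ?_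
  refine hasDecomposition_of_dilation hφ measurable_id hp0 (fun x h => ?_) hτ hτ1 (c := 1 / τ - 1)
    (by rw [sub_pos]; exact (one_lt_div hτ).2 hτ1)
    (fun x hx _ => (volume_restrict_Ici_block hx).ge) (δ := fun y => y / τ) (fun y => rfl) hN₀ hN₁
    (posBounded_cesaroAvg measurableSet_Ici le_rfl hI1 hN₀ hC₀)
    (posBounded_cesaroAvg measurableSet_Ici le_rfl hI1 hN₁ hC₁)
    (posBounded_dilation hτ hD₀) (posBounded_dilation hτ hD₁)
  have hsub : Ioc (max x 0) (max x 0 + 1) ⊆ {y | x < id y} ∩ Ici 0 := fun y hy =>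
    ⟨(le_max_left _ _).trans_lt hy.1, (le_max_right _ _).trans hy.1.le⟩
  have hm : MeasurableSet {y : ℝ | x < id y} := measurableSet_Ioi
  have h2 : volume ({y | x < id y} ∩ Ici 0) = 0 := by
    rw [← Measure.restrict_apply hm]
    exact h
  have h3 := measure_mono_null hsub h2
  rw [Real.volume_Ioc] at h3
  simp at h3

end HalfLine

/-! ### Cesàro sequence spaces -/

section Sequences

variable {N : (ℕ →ₘ[Measure.count] ℝ) → ℝ≥0∞}

/-- A sequence as an element of `L⁰(ℕ)`. -/
noncomputable def seq (a : ℕ → ℝ) : ℕ →ₘ[Measure.count] ℝ :=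
  AEEqFun.mk a (measurable_of_countable _).aestronglyMeasurable

theorem seq_apply (a : ℕ → ℝ) (n : ℕ) : seq a n = a n :=
  Measure.ae_count_iff.1 (AEEqFun.coeFn_mk a (measurable_of_countable _).aestronglyMeasurable) n

theorem seq_ext {a b : ℕ →ₘ[Measure.count] ℝ} (h : ∀ n, a n = b n) : a = b :=
  AEEqFun.ext (ae_of_all _ h)

theorem seq_add (a b : ℕ → ℝ) : seq (a + b) = seq a + seq b := by
  refine seq_ext fun n => ?_
  rw [Measure.ae_count_iff.1 (AEEqFun.coeFn_add (seq a) (seq b)) n, Pi.add_apply]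
  simp only [seq_apply, Pi.add_apply]

theorem seq_smul (c : ℝ) (a : ℕ → ℝ) : seq (c • a) = c • seq a := by
  refine seq_ext fun n => ?_
  rw [Measure.ae_count_iff.1 (AEEqFun.coeFn_smul c (seq a)) n, Pi.smul_apply]
  simp only [seq_apply, Pi.smul_apply]

/-- The section of a sequence consisting of its first `n` terms. -/
noncomputable def trunc (n : ℕ) (a : ℕ → ℝ) : ℕ → ℝ := fun k => if k < n then a k else 0

theorem trunc_add (n : ℕ) (a b : ℕ → ℝ) : trunc n (a + b) = trunc n a + trunc n b := by
  ext k; by_cases h : k < n <;> simp [trunc, h]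

theorem trunc_smul (n : ℕ) (c : ℝ) (a : ℕ → ℝ) : trunc n (c • a) = c • trunc n a := by
  ext k; by_cases h : k < n <;> simp [trunc, h]

theorem IsBanachIdeal.norm_zero {α : Type*} [MeasurableSpace α] {μ : Measure α}
    {N : (α →ₘ[μ] ℝ) → ℝ≥0∞} (hN : IsBanachIdeal N) : N 0 = 0 := by
  simpa using hN.smul 0 0

theorem IsBanachIdeal.norm_trunc_lt_top (hN : IsBanachIdeal N) (n : ℕ) (a : ℕ → ℝ) :
    N (seq (trunc n a)) < ∞ := by
  obtain ⟨w, hw, hpos⟩ := hN.weakUnit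
  rw [Measure.ae_count_iff] at hpos
  have hw' : N w < ∞ := hw
  set C : ℝ := ∑ k ∈ Finset.range n, |a k| / w k with hC
  have hterm : ∀ k, 0 ≤ |a k| / w k := fun k => div_nonneg (abs_nonneg _) (hpos k).le
  have hC0 : 0 ≤ C := Finset.sum_nonneg fun k _ => hterm k
  have hle : N (seq (trunc n a)) ≤ N (C • w) := by
    refine hN.isIdealNorm _ _ (ae_of_all _ fun k => ?_)
    rw [seq_apply, Measure.ae_count_iff.1 (AEEqFun.coeFn_smul C w) k, enorm_le_iff_norm_le,
      Pi.smul_apply, smul_eq_mul, Real.norm_eq_abs, Real.norm_eq_abs,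
      abs_of_nonneg (mul_nonneg hC0 (hpos k).le)]
    by_cases h : k < n
    · have : |a k| / w k ≤ C :=
        Finset.single_le_sum (f := fun k => |a k| / w k) (fun k _ => hterm k) (Finset.mem_range.2 h)
      rw [div_le_iff₀ (hpos k)] at this
      simpa [trunc, h] using this
    · simpa [trunc, h] using mul_nonneg hC0 (hpos k).le
  refine hle.trans_lt ?_
  rw [hN.smul]
  exact ENNReal.mul_lt_top enorm_lt_top hw'

/-- The Hahn–Banach theorem on the space of sequences with `n` terms: the norm of such a sequence
is attained against a functional of norm at most `1` in the Köthe dual. -/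
theorem IsBanachIdeal.exists_kotheDual_le_one (hN : IsBanachIdeal N) (n : ℕ) (b : ℕ → ℝ) :
    ∃ y : ℕ → ℝ, kotheDual N (seq y) ≤ 1 ∧
      N (seq (trunc n b)) = ENNReal.ofReal (∑ k ∈ Finset.range n, y k * b k) := by
  rcases eq_or_ne (trunc n b) 0 with hb | hb
  · refine ⟨0, ?_, ?_⟩
    · refine iSup₂_le fun g _ => ?_
      have : ∀ x, seq 0 x * g x = 0 := fun x => by rw [seq_apply]; simp
      simp [this]
    · have : seq (trunc n b) = 0 := by
        rw [hb, ← zero_smul ℝ (0 : ℕ → ℝ), seq_smul, zero_smul]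
      rw [this, hN.norm_zero]
      simp
  set P : (ℕ → ℝ) → ℝ := fun a => (N (seq (trunc n a))).toReal with hP
  have hfin : ∀ a, N (seq (trunc n a)) ≠ ∞ := fun a => (hN.norm_trunc_lt_top n a).ne
  have hPs : ∀ (c : ℝ) a, P (c • a) = |c| * P a := by
    intro c a
    simp only [hP, trunc_smul, seq_smul, hN.smul, ENNReal.toReal_mul, toReal_enorm,
      Real.norm_eq_abs]
  obtain ⟨ℓ, hℓ, hℓP⟩ := exists_extension_of_le_sublinear
    (LinearPMap.mkSpanSingleton (K := ℝ) (L := ℝ) (σ := RingHom.id ℝ) (trunc n b) (P (trunc n b)) hb)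
    P
    (fun c hc a => by rw [hPs, abs_of_pos hc])
    (fun a a' => by
      rw [hP]
      simp only [trunc_add, seq_add]
      rw [← ENNReal.toReal_add (hfin _) (hfin _)]
      exact ENNReal.toReal_mono (ENNReal.add_ne_top.2 ⟨hfin _, hfin _⟩) (hN.add_le _ _))
    (by
      rintro ⟨z, hz⟩
      obtain ⟨c, rfl⟩ := Submodule.mem_span_singleton.1 hz
      have := LinearPMap.mkSpanSingleton'_apply (σ := RingHom.id ℝ) (trunc n b) (P (trunc n b))
        (fun c hc => by
          rcases smul_eq_zero.1 hc with h | h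
          · simp [h]
          · exact absurd h hb) c hz
      refine this.le.trans ?_
      rw [hPs, RingHom.id_apply, smul_eq_mul]
      exact mul_le_mul_of_nonneg_right (le_abs_self c) ENNReal.toReal_nonneg)
  have hsum : ∀ a, ℓ (trunc n a) = ∑ k ∈ Finset.range n, ℓ (Pi.single k 1) * a k := by
    intro a
    have : trunc n a = ∑ k ∈ Finset.range n, a k • (Pi.single k 1 : ℕ → ℝ) := by
      ext j
      simp [trunc, Finset.sum_apply, Pi.single_apply]
    rw [this, map_sum]
    refine Finset.sum_congr rfl fun k _ => ?_
    rw [map_smul, smul_eq_mul, mul_comm]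
  have htt : ∀ a, trunc n (trunc n a) = trunc n a := by
    intro a; ext k; by_cases h : k < n <;> simp [trunc, h]
  refine ⟨trunc n fun k => ℓ (Pi.single k 1), ?_, ?_⟩
  · refine iSup₂_le fun g hg => ?_
    -- the signs of `g` are adjusted to those of the functional
    set s : ℕ → ℝ := fun k => SignType.sign (ℓ (Pi.single k 1)) * |g k| with hs
    have h1 : ℓ (trunc n s) ≤ 1 := by
      refine (hℓP _).trans ?_
      simp only [hP, htt]
      refine ENNReal.toReal_le_of_le_ofReal zero_le_one ?_
      rw [ENNReal.ofReal_one]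
      refine le_trans (hN.isIdealNorm _ _ (ae_of_all _ fun k => ?_)) hg
      rw [seq_apply, enorm_le_iff_norm_le]
      by_cases h : k < n
      · simp only [trunc, h, if_true, hs, norm_mul, Real.norm_eq_abs, abs_abs]
        refine mul_le_of_le_one_left (abs_nonneg _) ?_
        rcases lt_trichotomy (ℓ (Pi.single k 1)) 0 with h' | h' | h' <;> simp [h']
      · simp [trunc, h]
    rw [lintegral_count, tsum_eq_sum (s := Finset.range n)]
    · have h2 : ∀ k ∈ Finset.range n, ‖seq (trunc n fun k => ℓ (Pi.single k 1)) k * g k‖ₑ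
          = ENNReal.ofReal (ℓ (Pi.single k 1) * s k) := by
        intro k hk
        have e : ℓ (Pi.single k 1) * s k = |ℓ (Pi.single k 1) * g k| := by
          rw [hs, abs_mul, ← mul_assoc, mul_comm (ℓ _) (_ : ℝ), sign_mul_self]
        rw [seq_apply, e, ← Real.enorm_eq_ofReal_abs]
        simp [trunc, Finset.mem_range.1 hk]
      rw [Finset.sum_congr rfl h2, ← ENNReal.ofReal_sum_of_nonneg, ← hsum]
      · exact ENNReal.ofReal_le_one.2 h1
      · intro k _
        rw [hs, ← mul_assoc, mul_comm (ℓ _) (_ : ℝ), sign_mul_self]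
        positivity
    · intro k hk
      rw [seq_apply]
      simp only [Finset.mem_range] at hk
      simp [trunc, hk]
  · have h1 := hℓ ⟨trunc n b, Submodule.mem_span_singleton_self _⟩
    have h2 : ℓ (trunc n b) = P b := by
      refine h1.trans ((LinearPMap.mkSpanSingleton_apply ℝ ℝ hb _).trans ?_)
      simp only [hP, htt]
    rw [← ENNReal.ofReal_toReal (hfin b)]
    change ENNReal.ofReal (P b) = _
    rw [← h2, hsum]
    congr 1
    refine Finset.sum_congr rfl fun k hk => ?_
    simp [trunc, Finset.mem_range.1 hk]

theorem IsBanachIdeal.lintegral_mul_le {α : Type*} [MeasurableSpace α] {μ : Measure α}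
    {N : (α →ₘ[μ] ℝ) → ℝ≥0∞} (hN : IsBanachIdeal N) (f g : α →ₘ[μ] ℝ) (hg : N g ≠ ∞) :
    ∫⁻ x, ‖f x * g x‖ₑ ∂μ ≤ kotheDual N f * N g := by
  rcases eq_or_ne (N g) 0 with h | h
  · have h0 : ∀ᵐ x ∂μ, ‖f x * g x‖ₑ = 0 := by
      rw [hN.eq_zero g h]
      filter_upwards [AEEqFun.coeFn_zero (α := α) (β := ℝ) (μ := μ)] with x hx
      simp [hx]
    rw [lintegral_congr_ae h0]
    simp
  · set t : ℝ := (N g).toReal with ht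
    have ht0 : 0 < t := ENNReal.toReal_pos h hg
    have hgt : N g = ENNReal.ofReal t := (ENNReal.ofReal_toReal hg).symm
    have h1 : N (t⁻¹ • g) ≤ 1 := by
      rw [hN.smul, hgt, Real.enorm_of_nonneg (by positivity), ← ENNReal.ofReal_mul (by positivity),
        inv_mul_cancel₀ ht0.ne', ENNReal.ofReal_one]
    have h2 : ∫⁻ x, ‖f x * (t⁻¹ • g) x‖ₑ ∂μ ≤ kotheDual N f :=
      le_iSup₂ (f := fun (g : α →ₘ[μ] ℝ) (_ : N g ≤ 1) => ∫⁻ x, ‖f x * g x‖ₑ ∂μ) _ h1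
    calc ∫⁻ x, ‖f x * g x‖ₑ ∂μ = ∫⁻ x, ENNReal.ofReal t * ‖f x * (t⁻¹ • g) x‖ₑ ∂μ := by
          refine lintegral_congr_ae ?_
          filter_upwards [AEEqFun.coeFn_smul t⁻¹ g] with x hx
          rw [hx, Pi.smul_apply, smul_eq_mul, ← Real.enorm_of_nonneg ht0.le, ← enorm_mul]
          congr 1
          field_simp
      _ = ENNReal.ofReal t * ∫⁻ x, ‖f x * (t⁻¹ • g) x‖ₑ ∂μ :=
          lintegral_const_mul' _ _ ENNReal.ofReal_ne_top
      _ ≤ kotheDual N f * N g := by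
          rw [mul_comm, hgt]
          gcongr

/-- If `σ₃` is bounded on the Köthe dual, the operator `b ↦ (b₃, b₆, b₉, …)`, which is dominated by
the transpose of `σ₃`, is bounded on the space. The Fatou property reduces this to
finite sequences. -/
theorem posBounded_subsequence (hN : IsBanachIdeal N) (hF : HasFatou N)
    (hσ : BoundedOn (fun _ => True) (dilationSeq 3) (kotheDual N)) :
    PosBounded N (fun g k => g (3 * k + 2)) := by
  obtain ⟨K, hK⟩ := hσ
  have hmain : ∀ a : ℕ →ₘ[Measure.count] ℝ, N a ≠ ∞ →
      N (seq fun k => |a (3 * k + 2)|) ≤ K * N a := by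
    intro a ha
    set b : ℕ → ℝ := fun k => |a (3 * k + 2)| with hb
    have hn : ∀ n, N (seq (trunc n b)) ≤ K * N a := by
      intro n
      obtain ⟨y, hy, hyb⟩ := hN.exists_kotheDual_le_one n b
      have hKy : kotheDual N (dilationSeq 3 (seq y)) ≤ K := by
        refine (hK (seq y) (hy.trans_lt ENNReal.one_lt_top)).2.trans ?_
        exact mul_le_of_le_one_right zero_le hy
      have hd : ∀ k, dilationSeq 3 (seq y) (3 * k + 2) = y k := by
        intro k
        have := Measure.ae_count_iff.1 (AEEqFun.coeFn_mk (fun n => seq y (n / 3))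
          (measurable_of_countable _).aestronglyMeasurable) (3 * k + 2)
        rw [dilationSeq, this]
        change seq y ((3 * k + 2) / 3) = y k
        rw [seq_apply]
        congr 1
        omega
      calc N (seq (trunc n b)) = ENNReal.ofReal (∑ k ∈ Finset.range n, y k * b k) := hyb
        _ ≤ ∑ k ∈ Finset.range n, ‖y k * a (3 * k + 2)‖ₑ := by
            refine (ENNReal.ofReal_le_ofReal (Finset.sum_le_sum fun k _ => le_abs_self _)).trans ?_
            rw [ENNReal.ofReal_sum_of_nonneg fun _ _ => abs_nonneg _]
            refine Finset.sum_le_sum fun k _ => ?_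
            rw [Real.enorm_eq_ofReal_abs, hb, abs_mul, abs_mul, abs_abs]
        _ ≤ ∑' k, ‖y k * a (3 * k + 2)‖ₑ := ENNReal.sum_le_tsum _
        _ = ∑' k, (fun m => ‖dilationSeq 3 (seq y) m * a m‖ₑ) (3 * k + 2) := by
            simp only [hd]
        _ ≤ ∑' m, ‖dilationSeq 3 (seq y) m * a m‖ₑ :=
            ENNReal.tsum_comp_le_tsum_of_injective (fun i j h => by simpa using h) _
        _ = ∫⁻ m, ‖dilationSeq 3 (seq y) m * a m‖ₑ ∂Measure.count := (lintegral_count _).symm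
        _ ≤ kotheDual N (dilationSeq 3 (seq y)) * N a := hN.lintegral_mul_le _ _ ha
        _ ≤ K * N a := by gcongr
    have hb0 : ∀ k, 0 ≤ b k := fun k => abs_nonneg _
    have := hF (fun n => seq (trunc n b)) (seq b) (fun n => ?_) (fun m n hmn => ?_)
      (ae_of_all _ fun k => ?_) ((iSup_le hn).trans_lt (ENNReal.mul_lt_top ENNReal.coe_lt_top
        ha.lt_top))
    · exact le_of_tendsto' this.2 hn
    · rw [← AEEqFun.coeFn_le]
      filter_upwards [AEEqFun.coeFn_zero (α := ℕ) (β := ℝ) (μ := Measure.count)] with k hk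
      rw [hk, seq_apply, trunc, Pi.zero_apply]
      split_ifs
      exacts [hb0 k, le_rfl]
    · rw [← AEEqFun.coeFn_le]
      refine ae_of_all _ fun k => ?_
      rw [seq_apply, seq_apply, trunc, trunc]
      split_ifs with h1 h2
      exacts [le_rfl, absurd (h1.trans_le hmn) h2, hb0 k, le_rfl]
    · refine tendsto_const_nhds.congr' ?_
      filter_upwards [eventually_gt_atTop k] with n hn
      rw [seq_apply, seq_apply, trunc, if_pos hn]
  refine ⟨K, fun k g hg => ?_⟩
  obtain ⟨h, hhk, hgh⟩ := hg
  refine ⟨_, (hmain h (hhk.trans_lt ENNReal.coe_lt_top).ne).trans ?_, ae_of_all _ fun k => ?_⟩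
  · rw [ENNReal.coe_mul]
    gcongr
  · rw [seq_apply, Real.enorm_abs]
    exact Measure.ae_count_iff.1 hgh _

theorem cesaroAvg_count (g : ℕ → ℝ≥0∞) (n : ℕ) :
    cesaroAvg Measure.count (fun n : ℕ => (n : ℝ) + 1) g n
      = (∑ k ∈ Finset.range (n + 1), g k) / ENNReal.ofReal ((n : ℝ) + 1) := by
  have : {y : ℕ | (y : ℝ) + 1 ≤ (n : ℝ) + 1} = ↑(Finset.range (n + 1)) := by
    ext y
    simp
  rw [cesaroAvg, cumul, this, lintegral_finset]
  simp

theorem enorm_cesaroSeq_abs (a : ℕ →ₘ[Measure.count] ℝ) (n : ℕ) :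
    ‖cesaroSeq |a| n‖ₑ
      = cesaroAvg Measure.count (fun n : ℕ => (n : ℝ) + 1) (fun k => ‖a k‖ₑ) n := by
  have h1 : cesaroSeq |a| n = (1 / ((n : ℝ) + 1)) * ∑ k ∈ Finset.range (n + 1), |a| k :=
    Measure.ae_count_iff.1 (AEEqFun.coeFn_mk _ (measurable_of_countable _).aestronglyMeasurable) n
  have h2 : ∀ k, |a| k = |a k| := Measure.ae_count_iff.1 (AEEqFun.coeFn_abs a)
  rw [h1, cesaroAvg_count, Finset.sum_congr rfl fun k _ => h2 k,
    Real.enorm_of_nonneg (by positivity), ENNReal.ofReal_mul (by positivity), one_div,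
    ENNReal.ofReal_inv_of_pos (by positivity), ENNReal.ofReal_sum_of_nonneg fun _ _ => abs_nonneg _,
    mul_comm, div_eq_mul_inv]
  simp only [Real.enorm_eq_ofReal_abs]

theorem isCesaroNorm_cesaroSeqSpace (hN : IsIdealNorm N) :
    IsCesaroNorm (fun n : ℕ => (n : ℝ) + 1) N (cesaroSeqSpace N) := by
  intro a k
  have h := enorm_cesaroSeq_abs a
  refine ⟨fun hk => ⟨_, hk, ae_of_all _ fun n => (h n).ge⟩, fun hk => ?_⟩
  refine Dominated.norm_le hN (hk.mono le_rfl (ae_of_all _ fun n => (h n).le))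

theorem posBounded_cesaroAvg_count (hN : IsBanachIdeal N)
    (hC : BoundedOn (fun _ => True) cesaroSeq N) :
    PosBounded N (cesaroAvg Measure.count fun n : ℕ => (n : ℝ) + 1) := by
  obtain ⟨K, hK⟩ := hC
  refine ⟨K, fun k g hg => ?_⟩
  obtain ⟨h, hhk, hgh⟩ := hg
  have habs : N |h| ≤ N h := hN.isIdealNorm _ _ (by
    filter_upwards [AEEqFun.coeFn_abs h] with x hx
    rw [hx, Real.enorm_abs])
  refine ⟨cesaroSeq |h|, ?_, ae_of_all _ fun n => ?_⟩
  · refine (hK |h| ((habs.trans hhk).trans_lt ENNReal.coe_lt_top)).2.trans ?_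
    rw [ENNReal.coe_mul]
    gcongr
    exact habs.trans hhk
  · rw [enorm_cesaroSeq_abs]
    exact cesaroAvg_le_cesaroAvg hgh n

theorem spaceEq_sequences {N₀ N₁ : (ℕ →ₘ[Measure.count] ℝ) → ℝ≥0∞} (hN₀ : IsBanachIdeal N₀)
    (hN₁ : IsBanachIdeal N₁) (hF₀ : HasFatou N₀) (hF₁ : HasFatou N₁)
    (hC₀ : BoundedOn (fun _ => True) cesaroSeq N₀) (hC₁ : BoundedOn (fun _ => True) cesaroSeq N₁)
    (hσ₀ : BoundedOn (fun _ => True) (dilationSeq 3) (kotheDual N₀))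
    (hσ₁ : BoundedOn (fun _ => True) (dilationSeq 3) (kotheDual N₁))
    {φ : ℝ≥0 × ℝ≥0 → ℝ≥0} (hφ : ClassU φ) :
    SpaceEq (calderonLozanovskii φ (cesaroSeqSpace N₀) (cesaroSeqSpace N₁))
      (cesaroSeqSpace (calderonLozanovskii φ N₀ N₁)) := by
  have hp : Measurable fun n : ℕ => (n : ℝ) + 1 := measurable_of_countable _
  have hp0 : ∀ᵐ n : ℕ ∂Measure.count, (0 : ℝ) < (n : ℝ) + 1 := ae_of_all _ fun n => by positivity
  refine spaceEq_of_hasDecomposition hφ hp hp0 hN₀ hN₁ (isCesaroNorm_cesaroSeqSpace hN₀.isIdealNorm)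
    (isCesaroNorm_cesaroSeqSpace hN₁.isIdealNorm)
    (isCesaroNorm_cesaroSeqSpace isIdealNorm_calderonLozanovskii) ?_
  refine hasDecomposition_of_dilation hφ hp hp0 (fun x => ?_) (τ := 1 / 3) (c := 1) (by norm_num)
    (by norm_num) one_pos (fun x hx hx' => ?_) (δ := fun n => 3 * n + 2) (fun n => ?_) hN₀ hN₁
    (posBounded_cesaroAvg_count hN₀ hC₀) (posBounded_cesaroAvg_count hN₁ hC₁)
    (posBounded_subsequence hN₀ hF₀ hσ₀) (posBounded_subsequence hN₁ hF₁ hσ₁)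
  · obtain ⟨n, hn⟩ := exists_nat_gt x
    intro h
    rw [Measure.count_eq_zero_iff] at h
    have : n ∈ {y : ℕ | x < (y : ℝ) + 1} := by
      change x < (n : ℝ) + 1
      linarith
    rw [h] at this
    exact this
  · -- the interval `(x, 3x]` contains `⌊3x⌋ - ⌊x⌋ ≥ x` integers, because `x ≥ 1`
    have hx1 : 1 ≤ x := by
      by_contra hlt
      refine hx' ?_
      rw [Measure.count_eq_zero_iff, Set.eq_empty_iff_forall_notMem]
      intro n hn
      have hn : (n : ℝ) + 1 ≤ x := hn
      have : (0 : ℝ) ≤ n := n.cast_nonneg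
      linarith
    have hfl : ⌊x⌋₊ ≤ ⌊3 * x⌋₊ := Nat.floor_mono (by linarith)
    have hsub : (↑(Finset.Ico ⌊x⌋₊ ⌊3 * x⌋₊) : Set ℕ)
        ⊆ {y : ℕ | x < (y : ℝ) + 1 ∧ (y : ℝ) + 1 ≤ x / (1 / 3)} := by
      intro n hn
      rw [Finset.mem_coe, Finset.mem_Ico] at hn
      refine ⟨(Nat.lt_floor_add_one x).trans_le ?_, ?_⟩
      · have : (⌊x⌋₊ : ℝ) ≤ n := by exact_mod_cast hn.1
        linarith
      · have h1 : ((n + 1 : ℕ) : ℝ) ≤ ⌊3 * x⌋₊ := by exact_mod_cast hn.2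
        have h2 := Nat.floor_le (a := 3 * x) (by positivity)
        push_cast at h1
        linarith
    refine le_trans ?_ (measure_mono hsub)
    rw [Measure.count_apply_finset, Nat.card_Ico, ← ENNReal.ofReal_natCast, Nat.cast_sub hfl]
    refine ENNReal.ofReal_le_ofReal ?_
    have h1 := Nat.lt_floor_add_one (3 * x)
    have h2 := Nat.floor_le (a := x) (by positivity)
    linarith
  · push_cast
    ring

end Sequences

/-! ### The unit interval: the operators involved -/

section UnitInterval

/-- The Copson operator on nonnegative functions on `[0, 1]`. -/
noncomputable def copsonAvg (g : ℝ → ℝ≥0∞) (y : ℝ) : ℝ≥0∞ :=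
  ∫⁻ t in Ioc y 1, g t / ENNReal.ofReal t

theorem copsonAvg_anti (g : ℝ → ℝ≥0∞) : Antitone (copsonAvg g) := fun _ _ h =>
  lintegral_mono_set (Ioc_subset_Ioc_left h)

theorem Ioc_subset_Icc_unit : ∀ x ∈ Icc (0 : ℝ) 1, Ioc 0 x ⊆ Icc 0 1 := fun _ hx _ hy =>
  ⟨hy.1.le, hy.2.trans hx.2⟩

theorem ae_unit : ∀ᵐ x ∂(volume.restrict (Icc (0 : ℝ) 1)), 0 < x ∧ x < 1 := by
  have h1 : ∀ᵐ y : ℝ, y ≠ 1 := by simp [ae_iff]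
  filter_upwards [ae_restrict_pos (I := Icc (0 : ℝ) 1) measurableSet_Icc fun _ h => h.1,
    ae_restrict_of_ae h1] with x hx hx1
  exact ⟨hx.2, lt_of_le_of_ne hx.1.2 hx1⟩

theorem cumul_unit {x : ℝ} (hx : x ≤ 1) (g : ℝ → ℝ≥0∞) :
    cumul (volume.restrict (Icc (0 : ℝ) 1)) (fun y => y) g x = ∫⁻ y in Ioc 0 x, g y :=
  cumul_restrict (I := Icc (0 : ℝ) 1) (fun _ h => h.1) (fun _ hy => ⟨hy.1.le, hy.2.trans hx⟩) g

theorem cumul_Ici (x : ℝ) (g : ℝ → ℝ≥0∞) :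
    cumul (volume.restrict (Ici (0 : ℝ))) (fun y => y) g x = ∫⁻ y in Ioc 0 x, g y :=
  cumul_restrict le_rfl (fun _ hy => hy.1.le) g

variable {N : (ℝ →ₘ[volume.restrict (Icc (0 : ℝ) 1)] ℝ) → ℝ≥0∞}

theorem posBounded_copsonAvg (hN : IsBanachIdeal N) (hC : BoundedOn CopsonDefined copson N) :
    PosBounded N copsonAvg := by
  obtain ⟨K, hK⟩ := hC
  refine ⟨K, fun k g hg => ?_⟩
  obtain ⟨h, hhk, hgh⟩ := hg
  have habs : N |h| ≤ N h := hN.isIdealNorm _ _ (by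
    filter_upwards [AEEqFun.coeFn_abs h] with x hx
    rw [hx, Real.enorm_abs])
  obtain ⟨hD, hle⟩ := hK |h| ((habs.trans hhk).trans_lt ENNReal.coe_lt_top)
  refine ⟨copson |h|, hle.trans ?_, ?_⟩
  · rw [ENNReal.coe_mul]
    gcongr
    exact habs.trans hhk
  have hpt : ∀ᵐ t ∂(volume.restrict (Icc (0 : ℝ) 1)), g t / ENNReal.ofReal t ≤ ‖|h| t / t‖ₑ ∧
      |h| t / t = ‖|h| t / t‖ := by
    filter_upwards [hgh, AEEqFun.coeFn_abs h, ae_unit] with t h1 h2 h3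
    rw [h2, Real.norm_of_nonneg (div_nonneg (abs_nonneg _) h3.1.le)]
    refine ⟨?_, rfl⟩
    rw [Real.enorm_of_nonneg (div_nonneg (abs_nonneg _) h3.1.le), ENNReal.ofReal_div_of_pos h3.1,
      ← Real.enorm_eq_ofReal_abs]
    exact ENNReal.div_le_div_right h1 _
  filter_upwards [hD, ae_unit, AEEqFun.coeFn_mk _ (stronglyMeasurable_copson measurableSet_Icc
    |h|.stronglyMeasurable).aestronglyMeasurable] with x h1 h2 h3
  have hpt' : ∀ᵐ t ∂(volume.restrict (Icc (0 : ℝ) 1 ∩ Ici x)),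
      g t / ENNReal.ofReal t ≤ ‖|h| t / t‖ₑ ∧ |h| t / t = ‖|h| t / t‖ :=
    ae_mono (Measure.restrict_mono inter_subset_left le_rfl) hpt
  rw [copson, h3, integral_congr_ae (hpt'.mono fun t ht => ht.2),
    Real.enorm_of_nonneg (integral_nonneg fun _ => norm_nonneg _),
    ofReal_integral_norm_eq_lintegral_enorm h1]
  refine le_trans ?_ (lintegral_mono_ae (hpt'.mono fun t ht => ht.1))
  exact lintegral_mono_set fun t ht => ⟨⟨h2.1.le.trans ht.1.le, ht.2⟩, ht.1.le⟩

/-- The mass of `g`, as a constant function, is at most `Cg + C*g`. -/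
theorem posBounded_lintegral (hN : IsBanachIdeal N)
    (hC : PosBounded N (cesaroAvg (volume.restrict (Icc (0 : ℝ) 1)) fun y => y))
    (hC' : PosBounded N copsonAvg) : PosBounded N (fun g _ => ∫⁻ t in Ioc (0 : ℝ) 1, g t) := by
  refine (hC.add hN hC').mono fun g => ?_
  filter_upwards [ae_unit] with x hx
  have e : Ioc (0 : ℝ) 1 = Ioc 0 x ∪ Ioc x 1 := (Ioc_union_Ioc_eq_Ioc hx.1.le hx.2.le).symm
  rw [e, cesaroAvg, cumul_unit hx.2.le, copsonAvg]
  refine (lintegral_union_le _ _ _).trans (add_le_add ?_ ?_)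
  · rw [ENNReal.le_div_iff_mul_le (Or.inl (by simpa using hx.1)) (Or.inl (by simp))]
    exact mul_le_of_le_one_right zero_le (by simpa using hx.2.le)
  · refine setLIntegral_mono' measurableSet_Ioc fun t ht => ?_
    have ht0 : 0 < t := hx.1.trans ht.1
    rw [ENNReal.le_div_iff_mul_le (Or.inl (by simpa using ht0)) (Or.inl (by simp))]
    exact mul_le_of_le_one_right zero_le (by simpa using ht.2)

theorem measurePreserving_reflect : MeasurePreserving (fun x : ℝ => 1 - x)
    (volume.restrict (Icc (0 : ℝ) 1)) (volume.restrict (Icc (0 : ℝ) 1)) := by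
  have h := (Measure.measurePreserving_sub_left (volume : Measure ℝ) 1).restrict_preimage
    (measurableSet_Icc (a := (0 : ℝ)) (b := 1))
  have e : (fun x : ℝ => 1 - x) ⁻¹' Icc 0 1 = Icc 0 1 := by
    ext x
    simp only [mem_preimage, mem_Icc]
    constructor <;> rintro ⟨h1, h2⟩ <;> constructor <;> linarith
  rwa [e] at h

theorem lintegral_reflect {z : ℝ} (g : ℝ → ℝ≥0∞) :
    ∫⁻ s in Ioc z 1, g (1 - s) = ∫⁻ t in Ioc 0 (1 - z), g t := by
  have h := (Measure.measurePreserving_sub_left (volume : Measure ℝ)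
    1).setLIntegral_comp_preimage_emb (MeasurableEquiv.subLeft (1 : ℝ)).measurableEmbedding g
    (Ioc 0 (1 - z))
  have e : (fun x : ℝ => 1 - x) ⁻¹' Ioc 0 (1 - z) = Ico z 1 := by
    ext x
    simp only [mem_preimage, mem_Ioc, mem_Ico]
    constructor <;> rintro ⟨h1, h2⟩ <;> constructor <;> linarith
  rw [e] at h
  rw [← h]
  exact setLIntegral_congr Ioc_ae_eq_Icc |>.trans (setLIntegral_congr Ico_ae_eq_Icc).symm

theorem posBounded_reflect (hS : IsSymmetric N) : PosBounded N (fun g y => g (1 - y)) := by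
  refine ⟨1, fun k g hg => ?_⟩
  obtain ⟨h, hhk, hgh⟩ := hg
  have hmk := AEEqFun.coeFn_mk (μ := volume.restrict (Icc (0 : ℝ) 1)) (fun x => h (1 - x))
    (h.stronglyMeasurable.comp_measurable (measurable_const.sub measurable_id)).aestronglyMeasurable
  set r := AEEqFun.mk (μ := volume.restrict (Icc (0 : ℝ) 1)) (fun x => h (1 - x))
    (h.stronglyMeasurable.comp_measurable (measurable_const.sub measurable_id)).aestronglyMeasurable
  have hr := hS h r (fun l _ => ?_) (hhk.trans_lt ENNReal.coe_lt_top)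
  · refine ⟨r, ?_, ?_⟩
    · rw [one_mul, ← hr.2]
      exact hhk
    · filter_upwards [hmk, measurePreserving_reflect.quasiMeasurePreserving.ae hgh] with x h1 h2
      rw [h1]
      exact h2
  · have hm : MeasurableSet {x | l < |h x|} :=
      measurableSet_lt measurable_const h.stronglyMeasurable.measurable.abs
    rw [← measurePreserving_reflect.measure_preimage hm.nullMeasurableSet]
    refine measure_congr ?_
    filter_upwards [hmk] with x hx
    change (l < |h (1 - x)|) = (l < |r x|)
    rw [hx]

/-! ### The unit interval: the part of `f` near the origin -/

/-- The block decomposition near the origin with `τ = 1/2`. The bound on the mass of `fᵢ` is needed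
up to `1/16` only, so that the dilated point `8x` stays in `(0, 1/2]`. -/
theorem exists_decomposition_head {φ : ℝ≥0 × ℝ≥0 → ℝ≥0} (hφ : ClassU φ) {f g₀ g₁ : ℝ → ℝ≥0}
    (hf : Measurable f) (m₀ : Measurable g₀) (m₁ : Measurable g₁)
    (hg₀ : ∫⁻ t in Ioc (0 : ℝ) 1, g₀ t ≠ ∞) (hg₁ : ∫⁻ t in Ioc (0 : ℝ) 1, g₁ t ≠ ∞)
    (hle : ∀ᵐ x ∂(volume.restrict (Icc (0 : ℝ) 1)),
      cesaroAvg (volume.restrict (Icc (0 : ℝ) 1)) (fun y => y) (fun y => f y) x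
        ≤ φ (g₀ x, g₁ x)) :
    ∃ f₀ f₁ : ℝ → ℝ≥0, Measurable f₀ ∧ Measurable f₁ ∧
      (∀ᵐ x ∂(volume.restrict (Icc (0 : ℝ) 1)), x ≤ 1 / 2 → f x ≤ φ (f₀ x, f₁ x)) ∧
      (∀ x > 0, x ≤ 1 / 16 → ∫⁻ t in Ioc 0 x, f₀ t ≤ (8 : ℝ≥0) * ∫⁻ t in Ioc 0 (8 * x),
        cesaroAvg (volume.restrict (Icc (0 : ℝ) 1)) (fun y => y) (fun y => g₀ y) t) ∧
      (∀ x > 0, x ≤ 1 / 16 → ∫⁻ t in Ioc 0 x, f₁ t ≤ (8 : ℝ≥0) * ∫⁻ t in Ioc 0 (8 * x),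
        cesaroAvg (volume.restrict (Icc (0 : ℝ) 1)) (fun y => y) (fun y => g₁ y) t) := by
  -- the data are extended by zero to the half-line, where the block decomposition is available
  set ν := volume.restrict (Ici (0 : ℝ)) with hν
  set F : ℝ → ℝ≥0 := (Ioc (0 : ℝ) (1 / 2)).indicator f with hF
  set G₀ : ℝ → ℝ≥0 := (Ioc (0 : ℝ) 1).indicator g₀ with hG₀
  set G₁ : ℝ → ℝ≥0 := (Ioc (0 : ℝ) 1).indicator g₁ with hG₁
  have hp0 : ∀ᵐ x ∂ν, (0 : ℝ) < x :=
    (ae_restrict_pos (I := Ici (0 : ℝ)) measurableSet_Ici le_rfl).mono fun _ h => h.2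
  have hcoe : ∀ (g : ℝ → ℝ≥0) (t : ℝ), (((Ioc (0 : ℝ) 1).indicator g t : ℝ≥0) : ℝ≥0∞)
      = (Ioc (0 : ℝ) 1).indicator (fun t => (g t : ℝ≥0∞)) t := fun g t => by
    by_cases ht : t ∈ Ioc (0 : ℝ) 1 <;> simp [ht]
  have hfin : ∀ {g : ℝ → ℝ≥0}, ∫⁻ t in Ioc (0 : ℝ) 1, g t ≠ ∞ → ∀ x,
      cumul ν (fun y => y) (fun y => ((Ioc (0 : ℝ) 1).indicator g y : ℝ≥0)) x ≠ ∞ := by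
    intro g hg x
    rw [cumul_Ici]
    refine ne_top_of_le_ne_top hg ?_
    refine (setLIntegral_le_lintegral _ _).trans_eq ?_
    simp only [hcoe]
    exact lintegral_indicator measurableSet_Ioc _
  have hcum : ∀ (g : ℝ → ℝ≥0), ∀ t ∈ Ioc (0 : ℝ) 1,
      cesaroAvg ν (fun y => y) (fun y => ((Ioc (0 : ℝ) 1).indicator g y : ℝ≥0)) t
        = cesaroAvg (volume.restrict (Icc (0 : ℝ) 1)) (fun y => y) (fun y => g y) t := by
    intro g t ht
    rw [cesaroAvg, cesaroAvg, cumul_Ici, cumul_unit ht.2]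
    congr 1
    refine setLIntegral_congr_fun measurableSet_Ioc fun s hs => ?_
    have hs1 : s ∈ Ioc (0 : ℝ) 1 := ⟨hs.1, hs.2.trans ht.2⟩
    simp [hs1]
  have hle' : ∀ᵐ y ∂ν, y ≤ 1 → cesaroAvg ν (fun y => y) (fun y => F y) y ≤ φ (G₀ y, G₁ y) := by
    have h1 : ∀ᵐ y ∂(volume : Measure ℝ), y ∈ Icc (0 : ℝ) 1 → _ :=
      (ae_restrict_iff' measurableSet_Icc).1 hle
    filter_upwards [hp0, ae_restrict_of_ae h1] with y hy hy1 hy2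
    have hy3 : y ∈ Ioc (0 : ℝ) 1 := ⟨hy, hy2⟩
    have e0 : G₀ y = g₀ y := indicator_of_mem hy3 _
    have e1 : G₁ y = g₁ y := indicator_of_mem hy3 _
    rw [e0, e1]
    refine le_trans ?_ (hy1 ⟨hy.le, hy2⟩)
    rw [cesaroAvg, cesaroAvg, cumul_Ici, cumul_unit hy2]
    refine ENNReal.div_le_div_right (lintegral_mono fun s => ?_) _
    exact ENNReal.coe_le_coe.2 (indicator_le_self' (fun _ _ => zero_le) s)
  have hstep : ∀ x > 0, x ≤ 1 → cumul ν (fun y => y) (fun y => F y) (1 / 2 * x)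
      ≤ (4 : ℝ≥0) * φ ((cumul ν (fun y => y) (fun y => G₀ y) x).toNNReal,
        (cumul ν (fun y => y) (fun y => G₁ y) x).toNNReal) := by
    intro x hx hx1
    have := cumul_mul_le (μ := ν) (p := fun y => y) hφ measurable_id (τ := 1 / 2) (c := 1)
      (by norm_num) one_pos hx (fun _ => by
        have h := volume_restrict_Ici_block (x := 1 / 2 * x) (τ := 1 / 2) (by positivity)
        rw [show 1 / 2 * x / (1 / 2) = x by ring] at h
        rw [h]
        norm_num)
      (f := fun y => F y) (m₀.indicator measurableSet_Ioc) (m₁.indicator measurableSet_Ioc)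
      (hfin hg₀ x) (hfin hg₁ x) (hle'.mono fun y hy hyx => hy (hyx.trans hx1))
    have e : (2 * (1 / (1 * (1 / 2 : ℝ))).toNNReal : ℝ≥0) = 4 := by
      rw [show (1 / (1 * (1 / 2 : ℝ))) = ((2 : ℝ≥0) : ℝ) by norm_num, Real.toNNReal_coe]
      norm_num
    rwa [e] at this
  obtain ⟨f₀, f₁, n₀, n₁, hff, e₀, e₁⟩ := exists_decomposition_of_cumul_le (μ := ν)
    (p := fun y => y) hφ measurable_id hp0 (τ := 1 / 2) (c := 1) (by norm_num) (by norm_num) one_pos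
    (fun x hx _ => by
      rw [volume_restrict_Ici_block hx]
      norm_num) (A := 4) (f := F) (hf.indicator measurableSet_Ioc) (hfin hg₀) (hfin hg₁)
    (fun x hx => by
      rcases le_total x 1 with hx1 | hx1
      · exact hstep x hx hx1
      · -- beyond `1` nothing is added, as `F` is supported in `(0, 1/2]`
        calc cumul ν (fun y => y) (fun y => F y) (1 / 2 * x)
            ≤ cumul ν (fun y => y) (fun y => F y) (1 / 2 * 1) := by
              rw [cumul_Ici, cumul_Ici]
              have e : ∀ t, (F t : ℝ≥0∞) = (Ioc (0 : ℝ) (1 / 2)).indicator (fun t => (f t : ℝ≥0∞)) t :=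
                fun t => by by_cases ht : t ∈ Ioc (0 : ℝ) (1 / 2) <;> simp [hF]
              simp only [e, mul_one]
              refine (setLIntegral_le_lintegral _ _).trans ?_
              rw [lintegral_indicator measurableSet_Ioc, lintegral_indicator measurableSet_Ioc,
                Measure.restrict_restrict measurableSet_Ioc, inter_self]
          _ ≤ _ := hstep 1 one_pos le_rfl
          _ ≤ _ := by
              gcongr
              refine hφ.mono ?_ ?_
              · exact ENNReal.toNNReal_mono (hfin hg₀ x) (cumul_mono _ hx1)
              · exact ENNReal.toNNReal_mono (hfin hg₁ x) (cumul_mono _ hx1))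
  have e : (4 * (1 / (1 * (1 / 2 : ℝ))).toNNReal : ℝ≥0) = 8 := by
    rw [show (1 / (1 * (1 / 2 : ℝ))) = ((2 : ℝ≥0) : ℝ) by norm_num, Real.toNNReal_coe]
    norm_num
  rw [e] at e₀ e₁
  have hend : ∀ {h : ℝ → ℝ≥0} {g : ℝ → ℝ≥0}, (∀ x > 0, cumul ν (fun y => y) (fun y => h y) x ≤
      (8 : ℝ≥0) * cumul ν (fun y => y) (cesaroAvg ν (fun y => y)
        fun y => ((Ioc (0 : ℝ) 1).indicator g y : ℝ≥0)) (x / (1 / 2) ^ 3)) →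
      ∀ x > 0, x ≤ 1 / 16 → ∫⁻ t in Ioc 0 x, h t ≤ (8 : ℝ≥0) * ∫⁻ t in Ioc 0 (8 * x),
        cesaroAvg (volume.restrict (Icc (0 : ℝ) 1)) (fun y => y) (fun y => g y) t := by
    intro h g hyp x hx hx1
    have := hyp x hx
    rw [cumul_Ici, cumul_Ici, show x / (1 / 2) ^ 3 = 8 * x by ring] at this
    refine this.trans_eq ?_
    congr 1
    refine setLIntegral_congr_fun measurableSet_Ioc fun t ht => ?_
    exact hcum g t ⟨ht.1, ht.2.trans (by linarith)⟩
  refine ⟨f₀, f₁, n₀, n₁, ?_, hend e₀, hend e₁⟩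
  have h1 : ∀ᵐ y ∂(volume.restrict (Icc (0 : ℝ) 1)), F y ≤ φ (f₀ y, f₁ y) :=
    ae_mono (Measure.restrict_mono (fun _ h => h.1) le_rfl) hff
  filter_upwards [h1, ae_unit] with y hy hy1 hy2
  have : F y = f y := indicator_of_mem (show y ∈ Ioc (0 : ℝ) (1 / 2) from ⟨hy1.1, hy2⟩) _
  rwa [← this]

end UnitInterval

/-! ### The unit interval: the part of `f` away from the origin -/

section UnitIntervalTail

theorem cumul_inv {x : ℝ} (hx : 0 < x) (g : ℝ → ℝ≥0∞) :
    cumul (volume.restrict (Icc (0 : ℝ) 1)) (fun s => s⁻¹) g x = ∫⁻ s in Ioc x⁻¹ 1, g s := by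
  have hm : MeasurableSet {s : ℝ | s⁻¹ ≤ x} := measurableSet_le measurable_inv measurable_const
  rw [cumul, Measure.restrict_restrict hm]
  refine setLIntegral_congr ?_
  have h0 : ∀ᵐ s : ℝ, s ≠ 0 := by simp [ae_iff]
  have h1 : ∀ᵐ s : ℝ, s ≠ x⁻¹ := by simp [ae_iff]
  filter_upwards [h0, h1] with s hs hs1
  refine propext ⟨fun h => ?_, fun h => ?_⟩
  · have hs0 : 0 < s := lt_of_le_of_ne h.2.1 hs.symm
    exact ⟨lt_of_le_of_ne (inv_le_of_inv_le₀ hs0 h.1) hs1.symm, h.2.2⟩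
  · have hs0 : 0 < s := (inv_pos.2 hx).trans h.1
    exact ⟨inv_le_of_inv_le₀ hx h.1.le, hs0.le, h.2⟩

/-- The block decomposition for the position `s ↦ 1 / s`, whose initial segments are the intervals
`[y, 1]`. Averaging with respect to `dt / t` replaces the Cesàro averages, so that the Copson
operator appears. -/
theorem exists_decomposition_tail {φ : ℝ≥0 × ℝ≥0 → ℝ≥0} (hφ : ClassU φ) {f h₀ h₁ : ℝ → ℝ≥0}
    (hf : Measurable f) (m₀ : Measurable h₀) (m₁ : Measurable h₁)
    (hh₀ : ∀ y > 0, copsonAvg (fun t => h₀ t) y ≠ ∞)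
    (hh₁ : ∀ y > 0, copsonAvg (fun t => h₁ t) y ≠ ∞)
    (hle : ∀ᵐ s ∂(volume.restrict (Icc (0 : ℝ) 1)), ∫⁻ t in Ioc s 1, f t ≤ φ (h₀ s, h₁ s)) :
    ∃ f₀ f₁ : ℝ → ℝ≥0, Measurable f₀ ∧ Measurable f₁ ∧
      (∀ᵐ s ∂(volume.restrict (Icc (0 : ℝ) 1)), f s ≤ φ (f₀ s, f₁ s)) ∧
      (∀ y > 0, ∫⁻ t in Ioc y 1, f₀ t
        ≤ (8 : ℝ≥0) * copsonAvg (copsonAvg fun t => h₀ t) (y / 8)) ∧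
      (∀ y > 0, ∫⁻ t in Ioc y 1, f₁ t
        ≤ (8 : ℝ≥0) * copsonAvg (copsonAvg fun t => h₁ t) (y / 8)) := by
  have hp0 : ∀ᵐ s ∂(volume.restrict (Icc (0 : ℝ) 1)), 0 < s⁻¹ :=
    ae_unit.mono fun s hs => inv_pos.2 hs.1
  have hlt : ∀ {x : ℝ}, 0 < x → (1 / 2 * x)⁻¹ = 2 * x⁻¹ := fun {x} hx => by
    rw [mul_inv]; norm_num
  -- `∫_{2y}^1 f` is at most twice the integral of `∫_t^1 f` over `[y, 2y]` against `dt / t`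
  have hF : ∀ y > 0, ∫⁻ t in Ioc (2 * y) 1, f t ≤
      4 * φ ((copsonAvg (fun t => h₀ t) y).toNNReal, (copsonAvg (fun t => h₁ t) y).toNNReal) := by
    intro y hy
    rcases le_total 1 (2 * y) with h1 | h1
    · rw [Ioc_eq_empty (not_lt.2 h1)]
      simp
    have hdiv : ∀ (h : ℝ → ℝ≥0), ∫⁻ t in Ioc y 1, ((t.toNNReal⁻¹ * h t : ℝ≥0) : ℝ≥0∞)
        = copsonAvg (fun t => h t) y := by
      intro h
      refine setLIntegral_congr_fun measurableSet_Ioc fun t ht => ?_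
      have ht0 : t.toNNReal ≠ 0 := by simpa using hy.trans ht.1
      simp only
      rw [mul_comm, ← div_eq_mul_inv, ENNReal.coe_div ht0, ENNReal.ofReal]
    have hJ := hφ.lintegral_le (ν := volume.restrict (Ioc y 1))
      (g₀ := fun t => t.toNNReal⁻¹ * h₀ t) (g₁ := fun t => t.toNNReal⁻¹ * h₁ t)
      (measurable_real_toNNReal.inv.mul m₀).aemeasurable
      (measurable_real_toNNReal.inv.mul m₁).aemeasurable
      ((hdiv h₀).trans (ENNReal.coe_toNNReal (hh₀ y hy)).symm).le
      ((hdiv h₁).trans (ENNReal.coe_toNNReal (hh₁ y hy)).symm).le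
    set Z := ∫⁻ t in Ioc (2 * y) 1, (f t : ℝ≥0∞) with hZ
    have hle' : ∀ᵐ s ∂(volume.restrict (Ioc y (2 * y))),
        ∫⁻ t in Ioc s 1, f t ≤ φ (h₀ s, h₁ s) :=
      ae_mono (Measure.restrict_mono (s' := Icc (0 : ℝ) 1)
        (fun s hs => ⟨hy.le.trans hs.1.le, hs.2.trans h1⟩) le_rfl) hle
    calc Z = 2 * (Z / ENNReal.ofReal (2 * y) * ENNReal.ofReal (2 * y - y)) := by
          rw [show 2 * y - y = y by ring, ENNReal.ofReal_mul zero_le_two, ENNReal.ofReal_ofNat]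
          have hy0 : ENNReal.ofReal y ≠ 0 := by simpa using hy
          rw [div_eq_mul_inv, ENNReal.mul_inv (Or.inl two_ne_zero) (Or.inr hy0)]
          calc Z = Z * (2 * 2⁻¹) * ((ENNReal.ofReal y)⁻¹ * ENNReal.ofReal y) := by
                rw [ENNReal.mul_inv_cancel two_ne_zero ENNReal.ofNat_ne_top,
                  ENNReal.inv_mul_cancel hy0 ENNReal.ofReal_ne_top, mul_one, mul_one]
            _ = _ := by ring
      _ = 2 * ∫⁻ t in Ioc y (2 * y), Z / ENNReal.ofReal (2 * y) := by
          rw [setLIntegral_const, Real.volume_Ioc]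
      _ ≤ 2 * ∫⁻ t in Ioc y (2 * y), φ (t.toNNReal⁻¹ * h₀ t, t.toNNReal⁻¹ * h₁ t) := by
          refine mul_le_mul_right (lintegral_mono_ae ?_) _
          filter_upwards [hle', ae_restrict_mem measurableSet_Ioc] with s hs hs'
          have hs0 : s.toNNReal ≠ 0 := by simpa using hy.trans hs'.1
          rw [hφ.1, mul_comm s.toNNReal⁻¹, ← div_eq_mul_inv, ENNReal.coe_div hs0]
          refine ENNReal.div_le_div ?_ (ENNReal.ofReal_le_ofReal hs'.2)
          exact (lintegral_mono_set (Ioc_subset_Ioc_left hs'.2)).trans hs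
      _ ≤ 2 * ∫⁻ t in Ioc y 1, φ (t.toNNReal⁻¹ * h₀ t, t.toNNReal⁻¹ * h₁ t) :=
          mul_le_mul_right (lintegral_mono_set (Ioc_subset_Ioc_right h1)) _
      _ ≤ 2 * (2 * φ ((copsonAvg (fun t => h₀ t) y).toNNReal,
            (copsonAvg (fun t => h₁ t) y).toNNReal)) := mul_le_mul_right hJ _
      _ = _ := by rw [← mul_assoc]; norm_num
  have hV : ∀ {h : ℝ → ℝ≥0}, (∀ y > 0, copsonAvg (fun t => h t) y ≠ ∞) → ∀ x > 0,
      ((4 * (copsonAvg (fun t => h t) x⁻¹).toNNReal : ℝ≥0) : ℝ≥0∞) ≤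
      ∫⁻ s in {s | x < s⁻¹ ∧ s⁻¹ ≤ x / (1 / 2)},
        (8 : ℝ≥0) * (copsonAvg (fun t => h t) s / ENNReal.ofReal s)
          ∂(volume.restrict (Icc (0 : ℝ) 1)) := by
    intro h hh x hx
    obtain ⟨y, hy, rfl⟩ : ∃ y, 0 < y ∧ y⁻¹ = x := ⟨x⁻¹, by positivity, inv_inv x⟩
    rw [inv_inv, ENNReal.coe_mul, ENNReal.coe_toNNReal (hh y hy)]
    rcases le_or_gt 1 y with h1 | h1
    · rw [copsonAvg, Ioc_eq_empty (not_lt.2 h1)]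
      simp
    set W := copsonAvg (fun t => (h t : ℝ≥0∞)) with hW
    have hsub : Ioo (y / 2) y ⊆ {s | y⁻¹ < s⁻¹ ∧ s⁻¹ ≤ y⁻¹ / (1 / 2)} ∩ Icc 0 1 := by
      intro s hs
      have hs0 : 0 < s := (half_pos hy).trans hs.1
      refine ⟨⟨(inv_lt_inv₀ hy hs0).2 hs.2, ?_⟩, hs0.le, hs.2.le.trans h1.le⟩
      have := (inv_le_inv₀ hs0 (half_pos hy)).2 hs.1.le
      refine this.trans_eq ?_
      field_simp
    have hm : MeasurableSet {s : ℝ | y⁻¹ < s⁻¹ ∧ s⁻¹ ≤ y⁻¹ / (1 / 2)} :=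
      (measurableSet_lt measurable_const measurable_inv).inter
        (measurableSet_le measurable_inv measurable_const)
    rw [Measure.restrict_restrict hm]
    refine le_trans ?_ (lintegral_mono_set hsub)
    calc ((4 : ℝ≥0) : ℝ≥0∞) * W y
        = (8 : ℝ≥0) * (W y / ENNReal.ofReal y) * ENNReal.ofReal (y - y / 2) := by
          rw [show y - y / 2 = 2⁻¹ * y by ring, ENNReal.ofReal_mul (by norm_num),
            ENNReal.ofReal_inv_of_pos two_pos, ENNReal.ofReal_ofNat, div_eq_mul_inv]
          have hy0 : ENNReal.ofReal y ≠ 0 := by simpa using hy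
          have e8 : ((8 : ℝ≥0) : ℝ≥0∞) = 4 * 2 := by norm_num
          calc ((4 : ℝ≥0) : ℝ≥0∞) * W y
              = 4 * W y * (2 * 2⁻¹) * ((ENNReal.ofReal y)⁻¹ * ENNReal.ofReal y) := by
                rw [ENNReal.mul_inv_cancel two_ne_zero ENNReal.ofNat_ne_top,
                  ENNReal.inv_mul_cancel hy0 ENNReal.ofReal_ne_top, mul_one, mul_one]
                rfl
            _ = _ := by rw [e8]; ring
      _ = ∫⁻ s in Ioo (y / 2) y, (8 : ℝ≥0) * (W y / ENNReal.ofReal y) := by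
          rw [setLIntegral_const, Real.volume_Ioo]
      _ ≤ _ := by
          refine setLIntegral_mono' measurableSet_Ioo fun s hs => ?_
          refine mul_le_mul_right ?_ _
          exact ENNReal.div_le_div (copsonAvg_anti _ hs.2.le) (ENNReal.ofReal_le_ofReal hs.2.le)
  obtain ⟨f₀, f₁, n₀, n₁, hff, e₀, e₁⟩ := exists_block_decomposition
    (μ := volume.restrict (Icc (0 : ℝ) 1)) hφ measurable_inv hp0 (τ := 1 / 2) (by norm_num)
    (by norm_num) hf (fun x hx => by
      rw [cumul_inv (by positivity), hlt hx, hφ.1]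
      exact_mod_cast hF x⁻¹ (by positivity)) (hV hh₀) (hV hh₁)
  have hend : ∀ {h F : ℝ → ℝ≥0}, (∀ x > 0,
      cumul (volume.restrict (Icc (0 : ℝ) 1)) (fun s => s⁻¹) (fun s => F s) x ≤
      cumul (volume.restrict (Icc (0 : ℝ) 1)) (fun s => s⁻¹)
        (fun s => (8 : ℝ≥0) * (copsonAvg (fun t => h t) s / ENNReal.ofReal s))
          (x / (1 / 2) ^ 3)) →
      ∀ y > 0, ∫⁻ t in Ioc y 1, F t
        ≤ (8 : ℝ≥0) * copsonAvg (copsonAvg fun t => h t) (y / 8) := by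
    intro h F hyp y hy
    have := hyp y⁻¹ (by positivity)
    rw [cumul_inv (by positivity), inv_inv, cumul_inv (by positivity),
      lintegral_const_mul' _ _ ENNReal.coe_ne_top] at this
    rwa [show (y⁻¹ / (1 / 2) ^ 3)⁻¹ = y / 8 by field_simp; norm_num] at this
  exact ⟨f₀, f₁, n₀, n₁, hff, hend e₀, hend e₁⟩

end UnitIntervalTail

/-! ### The unit interval: conclusion -/

section UnitIntervalMain

theorem exists_mem_Ioo_of_ae {P : ℝ → Prop} (h : ∀ᵐ x ∂(volume.restrict (Icc (0 : ℝ) 1)), P x)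
    {y : ℝ} (hy : 0 < y) : ∃ s, 0 < s ∧ s < y ∧ P s := by
  by_contra hc
  push Not at hc
  have hm : 0 < min y 1 := lt_min hy one_pos
  have hsub : Ioo 0 (min y 1) ⊆ {x | ¬P x} ∩ Icc 0 1 := fun s hs =>
    ⟨hc s hs.1 (hs.2.trans_le (min_le_left _ _)), hs.1.le, (hs.2.trans_le (min_le_right _ _)).le⟩
  have h1 : volume ({x | ¬P x} ∩ Icc (0 : ℝ) 1) = 0 :=
    le_antisymm ((Measure.le_restrict_apply _ _).trans (ae_iff.1 h).le) zero_le
  have h2 := measure_mono_null hsub h1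
  rw [Real.volume_Ioo, ENNReal.ofReal_eq_zero] at h2
  linarith

/-- The Cesàro average of the part on `(0, 1/16]`: for small `x` the dilated average
`C C g(8x)` is controlled by the Copson operator, for the remaining `x` by a constant. -/
theorem cesaroAvg_head_le {k : ℝ → ℝ≥0} {g : ℝ → ℝ≥0∞}
    (h : ∀ x > 0, x ≤ 1 / 16 → ∫⁻ t in Ioc 0 x, k t ≤ (8 : ℝ≥0) * ∫⁻ t in Ioc 0 (8 * x),
        cesaroAvg (volume.restrict (Icc (0 : ℝ) 1)) (fun y => y) g t) {x : ℝ} (hx : 0 < x)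
    (hx1 : x < 1) :
    cesaroAvg (volume.restrict (Icc (0 : ℝ) 1)) (fun y => y)
      (fun t => ((Ioc (0 : ℝ) (1 / 16)).indicator k t : ℝ≥0)) x
    ≤ (256 : ℝ≥0) * copsonAvg (cesaroAvg (volume.restrict (Icc (0 : ℝ) 1)) (fun y => y)
        (cesaroAvg (volume.restrict (Icc (0 : ℝ) 1)) (fun y => y) g)) x
      + (128 : ℝ≥0) * ∫⁻ t in Ioc (0 : ℝ) 1,
        cesaroAvg (volume.restrict (Icc (0 : ℝ) 1)) (fun y => y) g t := by
  set G := cesaroAvg (volume.restrict (Icc (0 : ℝ) 1)) (fun y => y) g with hG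
  have hcoe : ∀ t, (((Ioc (0 : ℝ) (1 / 16)).indicator k t : ℝ≥0) : ℝ≥0∞)
      = (Ioc (0 : ℝ) (1 / 16)).indicator (fun t => (k t : ℝ≥0∞)) t := fun t => by
    by_cases ht : t ∈ Ioc (0 : ℝ) (1 / 16) <;> simp
  have hx0 : ENNReal.ofReal x ≠ 0 := by simpa using hx
  rw [cesaroAvg, cumul_unit hx1.le]
  simp only [hcoe]
  rw [lintegral_indicator measurableSet_Ioc, Measure.restrict_restrict measurableSet_Ioc]
  rcases le_or_gt x (1 / 16) with hx2 | hx2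
  · refine le_trans ?_ le_self_add
    set U := ∫⁻ t in Ioc 0 (8 * x), G t with hU
    have h1 : U / ENNReal.ofReal (32 * x) ≤ copsonAvg (cesaroAvg (volume.restrict (Icc (0 : ℝ) 1))
        (fun y => y) G) x := by
      calc U / ENNReal.ofReal (32 * x)
          = ∫⁻ t in Ioc (8 * x) (16 * x), U / ENNReal.ofReal (16 * x) / ENNReal.ofReal (16 * x) := by
            rw [setLIntegral_const, Real.volume_Ioc]
            simp only [div_eq_mul_inv]
            rw [← ENNReal.ofReal_inv_of_pos (by positivity), ← ENNReal.ofReal_inv_of_pos (by positivity),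
              mul_assoc, mul_assoc, ← ENNReal.ofReal_mul (by positivity),
              ← ENNReal.ofReal_mul (by positivity)]
            congr 2
            field_simp
            norm_num
        _ ≤ ∫⁻ t in Ioc (8 * x) (16 * x), cesaroAvg (volume.restrict (Icc (0 : ℝ) 1))
              (fun y => y) G t / ENNReal.ofReal t := by
            refine setLIntegral_mono' measurableSet_Ioc fun t ht => ?_
            refine ENNReal.div_le_div ?_ (ENNReal.ofReal_le_ofReal ht.2)
            rw [cesaroAvg, cumul_unit (ht.2.trans (by linarith))]
            exact ENNReal.div_le_div (lintegral_mono_set (Ioc_subset_Ioc_right ht.1.le))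
              (ENNReal.ofReal_le_ofReal ht.2)
        _ ≤ _ := lintegral_mono_set (Ioc_subset_Ioc (by linarith) (by linarith))
    calc (∫⁻ t in Ioc 0 (1 / 16) ∩ Ioc 0 x, (k t : ℝ≥0∞)) / ENNReal.ofReal x
        ≤ (8 : ℝ≥0) * U / ENNReal.ofReal x :=
          ENNReal.div_le_div_right ((lintegral_mono_set inter_subset_right).trans (h x hx hx2)) _
      _ = (256 : ℝ≥0) * (U / ENNReal.ofReal (32 * x)) := by
          rw [ENNReal.ofReal_mul (by norm_num), div_eq_mul_inv, div_eq_mul_inv,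
            ENNReal.mul_inv (by norm_num) (by norm_num)]
          have e : ((256 : ℝ≥0) : ℝ≥0∞) * (ENNReal.ofReal 32)⁻¹ = 8 := by
            rw [ENNReal.ofReal_ofNat, show ((256 : ℝ≥0) : ℝ≥0∞) = 8 * 32 by norm_num, mul_assoc,
              ENNReal.mul_inv_cancel (by norm_num) (by norm_num), mul_one]
          calc ((8 : ℝ≥0) : ℝ≥0∞) * U * (ENNReal.ofReal x)⁻¹
              = (((256 : ℝ≥0) : ℝ≥0∞) * (ENNReal.ofReal 32)⁻¹) * U * (ENNReal.ofReal x)⁻¹ := by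
                rw [e]; rfl
            _ = _ := by ring
      _ ≤ _ := mul_le_mul_right h1 _
  · refine le_trans ?_ le_add_self
    have h1 := h (1 / 16) (by norm_num) le_rfl
    calc (∫⁻ t in Ioc 0 (1 / 16) ∩ Ioc 0 x, (k t : ℝ≥0∞)) / ENNReal.ofReal x
        ≤ ((8 : ℝ≥0) * ∫⁻ t in Ioc (0 : ℝ) 1, G t) / ENNReal.ofReal (1 / 16) := by
          refine ENNReal.div_le_div ?_ (ENNReal.ofReal_le_ofReal hx2.le)
          refine (lintegral_mono_set inter_subset_left).trans (h1.trans ?_)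
          refine mul_le_mul_right (lintegral_mono_set (Ioc_subset_Ioc_right (by norm_num))) _
      _ = _ := by
          rw [one_div, ENNReal.ofReal_inv_of_pos (by norm_num), div_eq_mul_inv, inv_inv,
            ENNReal.ofReal_ofNat, mul_right_comm]
          congr 1
          norm_num

/-- The Cesàro average of the part on `(1/16, 1]`, in terms of the reflected variable. The
expanding dilation `y ↦ y / 8` of a decreasing function is controlled by the Cesàro operator. -/
theorem cesaroAvg_tail_le {k : ℝ → ℝ≥0} {h : ℝ → ℝ≥0∞}
    (hk : ∀ y > 0, ∫⁻ t in Ioc y 1, k t ≤ (8 : ℝ≥0) * copsonAvg (copsonAvg h) (y / 8)) {x : ℝ}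
    (hx : 0 < x) (hx1 : x < 1) :
    cesaroAvg (volume.restrict (Icc (0 : ℝ) 1)) (fun y => y)
      (fun t => ((Ioc (1 / 16 : ℝ) 1).indicator (fun t => k (1 - t)) t : ℝ≥0)) x
    ≤ (1024 : ℝ≥0) * cesaroAvg (volume.restrict (Icc (0 : ℝ) 1)) (fun y => y)
        (copsonAvg (copsonAvg h)) (1 - x) := by
  have hcoe : ∀ t, (((Ioc (1 / 16 : ℝ) 1).indicator (fun t => k (1 - t)) t : ℝ≥0) : ℝ≥0∞)
      = (Ioc (1 / 16 : ℝ) 1).indicator (fun t => (k (1 - t) : ℝ≥0∞)) t := fun t => by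
    by_cases ht : t ∈ Ioc (1 / 16 : ℝ) 1 <;> simp
  have hy : 0 < 1 - x := by linarith
  rw [cesaroAvg, cumul_unit hx1.le]
  simp only [hcoe]
  rw [lintegral_indicator measurableSet_Ioc, Measure.restrict_restrict measurableSet_Ioc]
  rcases le_or_gt x (1 / 16) with hx2 | hx2
  · have : Ioc (1 / 16 : ℝ) 1 ∩ Ioc 0 x = ∅ := by
      ext t
      simp only [mem_inter_iff, mem_Ioc, mem_empty_iff_false, iff_false]
      rintro ⟨⟨h1, -⟩, -, h2⟩
      linarith
    rw [this]
    simp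
  set G := copsonAvg (copsonAvg h) with hG
  have h1 : G ((1 - x) / 8) ≤ (8 : ℝ≥0) *
      cesaroAvg (volume.restrict (Icc (0 : ℝ) 1)) (fun y => y) G (1 - x) := by
    set y := 1 - x with hy'
    have hy0 : ENNReal.ofReal (y / 8) ≠ 0 := by simpa using hy
    calc G (y / 8) = (8 : ℝ≥0) * ((∫⁻ t in Ioc 0 (y / 8), G (y / 8)) / ENNReal.ofReal y) := by
          rw [setLIntegral_const, Real.volume_Ioc, sub_zero]
          have e : ENNReal.ofReal y = 8 * ENNReal.ofReal (y / 8) := by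
            rw [show y = 8 * (y / 8) by ring, ENNReal.ofReal_mul (by norm_num),
              ENNReal.ofReal_ofNat]
            congr 2
            ring
          rw [e, div_eq_mul_inv (G (y / 8) * ENNReal.ofReal (y / 8)),
            ENNReal.mul_inv (by norm_num) (by norm_num)]
          have e8 : ((8 : ℝ≥0) : ℝ≥0∞) * 8⁻¹ = 1 := ENNReal.mul_inv_cancel (by norm_num) (by norm_num)
          calc G (y / 8) = G (y / 8) * (((8 : ℝ≥0) : ℝ≥0∞) * 8⁻¹) *
                (ENNReal.ofReal (y / 8) * (ENNReal.ofReal (y / 8))⁻¹) := by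
                rw [e8, ENNReal.mul_inv_cancel hy0 ENNReal.ofReal_ne_top, mul_one, mul_one]
            _ = _ := by ring
      _ ≤ _ := by
          refine mul_le_mul_right ?_ _
          rw [cesaroAvg, cumul_unit (by linarith)]
          refine ENNReal.div_le_div_right ?_ _
          refine (setLIntegral_mono' measurableSet_Ioc fun t ht => copsonAvg_anti _ ht.2).trans ?_
          exact lintegral_mono_set (Ioc_subset_Ioc_right (by linarith))
  have h2 : ∫⁻ t in Ioc 0 x, (k (1 - t) : ℝ≥0∞) = ∫⁻ s in Ioc (1 - x) 1, (k s : ℝ≥0∞) := by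
    have := lintegral_reflect (z := 1 - x) (fun t => (k (1 - t) : ℝ≥0∞))
    simp only [sub_sub_cancel] at this
    exact this.symm
  calc (∫⁻ t in Ioc (1 / 16 : ℝ) 1 ∩ Ioc 0 x, (k (1 - t) : ℝ≥0∞)) / ENNReal.ofReal x
      ≤ ((8 : ℝ≥0) * ((8 : ℝ≥0) *
        cesaroAvg (volume.restrict (Icc (0 : ℝ) 1)) (fun y => y) G (1 - x))) /
          ENNReal.ofReal (1 / 16) := by
        refine ENNReal.div_le_div ?_ (ENNReal.ofReal_le_ofReal hx2.le)
        refine (lintegral_mono_set inter_subset_right).trans (h2.le.trans ((hk _ hy).trans ?_))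
        exact mul_le_mul_right h1 _
    _ = _ := by
        rw [one_div, ENNReal.ofReal_inv_of_pos (by norm_num), div_eq_mul_inv, inv_inv,
          ENNReal.ofReal_ofNat, ← mul_assoc, mul_right_comm]
        congr 1
        norm_num

theorem spaceEq_unitInterval {N₀ N₁ : (ℝ →ₘ[volume.restrict (Icc (0 : ℝ) 1)] ℝ) → ℝ≥0∞}
    (hN₀ : IsBanachIdeal N₀) (hN₁ : IsBanachIdeal N₁)
    (hS₀ : IsSymmetric N₀) (hS₁ : IsSymmetric N₁)
    (hC₀ : BoundedOn CesaroDefined cesaro N₀) (hC₁ : BoundedOn CesaroDefined cesaro N₁)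
    (hD₀ : BoundedOn CopsonDefined copson N₀) (hD₁ : BoundedOn CopsonDefined copson N₁)
    {φ : ℝ≥0 × ℝ≥0 → ℝ≥0} (hφ : ClassU φ) :
    SpaceEq (calderonLozanovskii φ (cesaroSpace N₀) (cesaroSpace N₁))
      (cesaroSpace (calderonLozanovskii φ N₀ N₁)) := by
  have hI0 : Icc (0 : ℝ) 1 ⊆ Ici 0 := fun _ h => h.1
  have hI1 := Ioc_subset_Icc_unit
  refine spaceEq_of_hasDecomposition (p := fun y => y) hφ measurable_id (ae_unit.mono fun x hx => hx.1) hN₀ hN₁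
    (isCesaroNorm_cesaroSpace measurableSet_Icc hI0 hI1 hN₀.isIdealNorm)
    (isCesaroNorm_cesaroSpace measurableSet_Icc hI0 hI1 hN₁.isIdealNorm)
    (isCesaroNorm_cesaroSpace measurableSet_Icc hI0 hI1 isIdealNorm_calderonLozanovskii) ?_
  -- the sum of the operators controlling the two parts of the decomposition
  have hop : ∀ {N : (ℝ →ₘ[volume.restrict (Icc (0 : ℝ) 1)] ℝ) → ℝ≥0∞}, IsBanachIdeal N →
      IsSymmetric N → BoundedOn CesaroDefined cesaro N → BoundedOn CopsonDefined copson N →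
      PosBounded N (fun g x =>
        ((256 : ℝ≥0) * copsonAvg (cesaroAvg (volume.restrict (Icc (0 : ℝ) 1)) (fun y => y)
          (cesaroAvg (volume.restrict (Icc (0 : ℝ) 1)) (fun y => y) g)) x
        + (128 : ℝ≥0) * ∫⁻ t in Ioc (0 : ℝ) 1,
          cesaroAvg (volume.restrict (Icc (0 : ℝ) 1)) (fun y => y) g t)
        + (1024 : ℝ≥0) * cesaroAvg (volume.restrict (Icc (0 : ℝ) 1)) (fun y => y)
        (copsonAvg (copsonAvg fun t => g (1 - t))) (1 - x)) := by
    intro N hN hS hC hD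
    have hC' := posBounded_cesaroAvg measurableSet_Icc hI0 hI1 hN hC
    have hD' := posBounded_copsonAvg hN hD
    have hR := posBounded_reflect hS
    have hL := posBounded_lintegral hN hC' hD'
    exact (((hD'.comp (hC'.comp hC')).const_mul hN 256).add hN
      ((hL.comp hC').const_mul hN 128)).add hN
      ((hR.comp (hC'.comp (hD'.comp (hD'.comp hR)))).const_mul hN 1024)
  have hfin : ∀ {N : (ℝ →ₘ[volume.restrict (Icc (0 : ℝ) 1)] ℝ) → ℝ≥0∞}, IsBanachIdeal N →
      IsSymmetric N → BoundedOn CesaroDefined cesaro N → BoundedOn CopsonDefined copson N →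
      ∀ {g : ℝ → ℝ≥0}, Dominated N 1 (fun x => g x) → ∫⁻ t in Ioc (0 : ℝ) 1, g t ≠ ∞ ∧
        ∀ y > 0, copsonAvg (fun t => g (1 - t)) y ≠ ∞ := by
    intro N hN hS hC hD g hg
    have hD' := posBounded_copsonAvg hN hD
    obtain ⟨K, hK⟩ := posBounded_lintegral hN
      (posBounded_cesaroAvg measurableSet_Icc hI0 hI1 hN hC) hD'
    obtain ⟨K', hK'⟩ := hD'.comp (posBounded_reflect hS)
    refine ⟨?_, fun y hy => ?_⟩
    · obtain ⟨s, -, -, hs⟩ := exists_mem_Ioo_of_ae (hK _ _ hg).lt_top one_pos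
      exact hs.ne
    · obtain ⟨s, -, hsy, hs⟩ := exists_mem_Ioo_of_ae (hK' _ _ hg).lt_top hy
      exact ((copsonAvg_anti _ hsy.le).trans_lt hs).ne
  obtain ⟨K₀, hK₀⟩ := hop hN₀ hS₀ hC₀ hD₀
  obtain ⟨K₁, hK₁⟩ := hop hN₁ hS₁ hC₁ hD₁
  refine ⟨max K₀ K₁, fun f g₀ g₁ hf m₀ m₁ hg₀ hg₁ hle => ?_⟩
  obtain ⟨hfin₀, hfin₀'⟩ := hfin hN₀ hS₀ hC₀ hD₀ hg₀
  obtain ⟨hfin₁, hfin₁'⟩ := hfin hN₁ hS₁ hC₁ hD₁ hg₁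
  have hrm : Measurable fun t : ℝ => 1 - t := measurable_const.sub measurable_id
  obtain ⟨a₀, a₁, ma₀, ma₁, ha, ha₀, ha₁⟩ :=
    exists_decomposition_head hφ hf m₀ m₁ hfin₀ hfin₁ hle
  obtain ⟨b₀, b₁, mb₀, mb₁, hb, hb₀, hb₁⟩ := exists_decomposition_tail hφ (f := fun s => f (1 - s))
    (h₀ := fun s => g₀ (1 - s)) (h₁ := fun s => g₁ (1 - s)) (hf.comp hrm) (m₀.comp hrm)
    (m₁.comp hrm) hfin₀' hfin₁' (by
      filter_upwards [measurePreserving_reflect.quasiMeasurePreserving.ae hle, ae_unit] with s h1 h2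
      refine le_trans ?_ h1
      have hs : 0 < 1 - s := by linarith
      have e := lintegral_reflect (z := s) (fun t => (f t : ℝ≥0∞))
      rw [e, cesaroAvg, cumul_unit (by linarith),
        ENNReal.le_div_iff_mul_le (Or.inl (by simpa using hs)) (Or.inl (by simp))]
      refine mul_le_of_le_one_right zero_le ?_
      rw [ENNReal.ofReal_le_one]
      linarith)
  have hsum : ∀ {k l : ℝ → ℝ≥0}, Measurable k → ∀ x,
      cesaroAvg (volume.restrict (Icc (0 : ℝ) 1)) (fun y => y) (fun t => ((k t + l t : ℝ≥0))) x
      = cesaroAvg (volume.restrict (Icc (0 : ℝ) 1)) (fun y => y) (fun t => k t) x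
        + cesaroAvg (volume.restrict (Icc (0 : ℝ) 1)) (fun y => y) (fun t => l t) x := by
    intro k l hk x
    simp only [cesaroAvg, cumul, ENNReal.coe_add]
    rw [lintegral_add_left hk.coe_nnreal_ennreal, ENNReal.add_div]
  have hbound : ∀ {g a b : ℝ → ℝ≥0}, Measurable a →
      (∀ x > 0, x ≤ 1 / 16 → ∫⁻ t in Ioc 0 x, a t ≤ (8 : ℝ≥0) * ∫⁻ t in Ioc 0 (8 * x),
        cesaroAvg (volume.restrict (Icc (0 : ℝ) 1)) (fun y => y) (fun y => g y) t) →
      (∀ y > 0, ∫⁻ t in Ioc y 1, b t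
        ≤ (8 : ℝ≥0) * copsonAvg (copsonAvg fun t => g (1 - t)) (y / 8)) →
      ∀ᵐ x ∂(volume.restrict (Icc (0 : ℝ) 1)),
      cesaroAvg (volume.restrict (Icc (0 : ℝ) 1)) (fun y => y)
        (fun t => (((Ioc (0 : ℝ) (1 / 16)).indicator a t
          + (Ioc (1 / 16 : ℝ) 1).indicator (fun t => b (1 - t)) t : ℝ≥0))) x ≤
      ((256 : ℝ≥0) * copsonAvg (cesaroAvg (volume.restrict (Icc (0 : ℝ) 1)) (fun y => y)
          (cesaroAvg (volume.restrict (Icc (0 : ℝ) 1)) (fun y => y) fun y => g y)) x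
        + (128 : ℝ≥0) * ∫⁻ t in Ioc (0 : ℝ) 1,
          cesaroAvg (volume.restrict (Icc (0 : ℝ) 1)) (fun y => y) (fun y => g y) t)
        + (1024 : ℝ≥0) * cesaroAvg (volume.restrict (Icc (0 : ℝ) 1)) (fun y => y)
        (copsonAvg (copsonAvg fun t => g (1 - t))) (1 - x) := by
    intro g a b hma h1 h2
    filter_upwards [ae_unit] with x hx
    rw [hsum (hma.indicator measurableSet_Ioc)]
    exact add_le_add (cesaroAvg_head_le h1 hx.1 hx.2) (cesaroAvg_tail_le h2 hx.1 hx.2)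
  refine ⟨_, _, (ma₀.indicator measurableSet_Ioc).add ((mb₀.comp hrm).indicator measurableSet_Ioc),
    (ma₁.indicator measurableSet_Ioc).add ((mb₁.comp hrm).indicator measurableSet_Ioc), ?_,
    (hK₀ _ _ hg₀).mono (by rw [mul_one]; exact le_max_left _ _) (hbound ma₀ ha₀ hb₀),
    (hK₁ _ _ hg₁).mono (by rw [mul_one]; exact le_max_right _ _) (hbound ma₁ ha₁ hb₁)⟩
  filter_upwards [ha, measurePreserving_reflect.quasiMeasurePreserving.ae hb, ae_unit]
    with x h1 h2 hx
  simp only [sub_sub_cancel] at h2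
  rcases le_or_gt x (1 / 16) with hx2 | hx2
  · have hmem : x ∈ Ioc (0 : ℝ) (1 / 16) := ⟨hx.1, hx2⟩
    refine (h1 (by linarith)).trans (hφ.mono ?_ ?_)
    · rw [Pi.add_apply, indicator_of_mem hmem]; exact le_self_add
    · rw [Pi.add_apply, indicator_of_mem hmem]; exact le_self_add
  · have hmem : x ∈ Ioc (1 / 16 : ℝ) 1 := ⟨hx2, hx.2.le⟩
    refine h2.trans (hφ.mono ?_ ?_)
    · rw [Pi.add_apply, indicator_of_mem hmem]; exact le_add_self
    · rw [Pi.add_apply, indicator_of_mem hmem]; exact le_add_self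

end UnitIntervalMain

end CesaroCL

theorem theorem3 :
    -- the half-line `I = [0, ∞)`
    (∀ X₀ X₁ : (ℝ →ₘ[volume.restrict (Ici (0 : ℝ))] ℝ) → ℝ≥0∞,
      CesaroCL.IsBanachIdeal X₀ → CesaroCL.IsBanachIdeal X₁ →
      CesaroCL.HasFatou X₀ → CesaroCL.HasFatou X₁ →
      CesaroCL.BoundedOn CesaroCL.CesaroDefined CesaroCL.cesaro X₀ →
      CesaroCL.BoundedOn CesaroCL.CesaroDefined CesaroCL.cesaro X₁ →
      (∃ τ : ℝ, 0 < τ ∧ τ < 1 ∧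
        CesaroCL.BoundedOn (fun _ => True) (CesaroCL.dilation τ) X₀ ∧
        CesaroCL.BoundedOn (fun _ => True) (CesaroCL.dilation τ) X₁) →
      ∀ φ : ℝ≥0 × ℝ≥0 → ℝ≥0, CesaroCL.ClassU φ →
        CesaroCL.SpaceEq
          (CesaroCL.calderonLozanovskii φ (CesaroCL.cesaroSpace X₀) (CesaroCL.cesaroSpace X₁))
          (CesaroCL.cesaroSpace (CesaroCL.calderonLozanovskii φ X₀ X₁))) ∧
    -- the interval `I = [0, 1]`
    (∀ X₀ X₁ : (ℝ →ₘ[volume.restrict (Icc (0 : ℝ) 1)] ℝ) → ℝ≥0∞,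
      CesaroCL.IsBanachIdeal X₀ → CesaroCL.IsBanachIdeal X₁ →
      CesaroCL.HasFatou X₀ → CesaroCL.HasFatou X₁ →
      CesaroCL.IsSymmetric X₀ → CesaroCL.IsSymmetric X₁ →
      CesaroCL.BoundedOn CesaroCL.CesaroDefined CesaroCL.cesaro X₀ →
      CesaroCL.BoundedOn CesaroCL.CesaroDefined CesaroCL.cesaro X₁ →
      CesaroCL.BoundedOn CesaroCL.CopsonDefined CesaroCL.copson X₀ →
      CesaroCL.BoundedOn CesaroCL.CopsonDefined CesaroCL.copson X₁ →
      ∀ φ : ℝ≥0 × ℝ≥0 → ℝ≥0, CesaroCL.ClassU φ →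
        CesaroCL.SpaceEq
          (CesaroCL.calderonLozanovskii φ (CesaroCL.cesaroSpace X₀) (CesaroCL.cesaroSpace X₁))
          (CesaroCL.cesaroSpace (CesaroCL.calderonLozanovskii φ X₀ X₁))) ∧
    -- sequence spaces
    (∀ X₀ X₁ : (ℕ →ₘ[Measure.count] ℝ) → ℝ≥0∞,
      CesaroCL.IsBanachIdeal X₀ → CesaroCL.IsBanachIdeal X₁ →
      CesaroCL.HasFatou X₀ → CesaroCL.HasFatou X₁ →
      CesaroCL.BoundedOn (fun _ => True) CesaroCL.cesaroSeq X₀ →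
      CesaroCL.BoundedOn (fun _ => True) CesaroCL.cesaroSeq X₁ →
      CesaroCL.BoundedOn (fun _ => True) (CesaroCL.dilationSeq 3) (CesaroCL.kotheDual X₀) →
      CesaroCL.BoundedOn (fun _ => True) (CesaroCL.dilationSeq 3) (CesaroCL.kotheDual X₁) →
      ∀ φ : ℝ≥0 × ℝ≥0 → ℝ≥0, CesaroCL.ClassU φ →
        CesaroCL.SpaceEq
          (CesaroCL.calderonLozanovskii φ
            (CesaroCL.cesaroSeqSpace X₀) (CesaroCL.cesaroSeqSpace X₁))
          (CesaroCL.cesaroSeqSpace (CesaroCL.calderonLozanovskii φ X₀ X₁))) := by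
  refine ⟨?_, ?_, ?_⟩
  · rintro X₀ X₁ h₀ h₁ - - hC₀ hC₁ ⟨τ, hτ, hτ1, hD₀, hD₁⟩ φ hφ
    exact CesaroCL.spaceEq_halfLine h₀ h₁ hC₀ hC₁ hτ hτ1 hD₀ hD₁ hφ
  · intro X₀ X₁ h₀ h₁ _ _ hS₀ hS₁ hC₀ hC₁ hD₀ hD₁ φ hφ
    exact CesaroCL.spaceEq_unitInterval h₀ h₁ hS₀ hS₁ hC₀ hC₁ hD₀ hD₁ hφ
  · intro X₀ X₁ h₀ h₁ hF₀ hF₁ hC₀ hC₁ hσ₀ hσ₁ φ hφ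
    exact CesaroCL.spaceEq_sequences h₀ h₁ hF₀ hF₁ hC₀ hC₁ hσ₀ hσ₁ hφ
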